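/- Algorithms are deterministic random access machines (RAM with logarithmic cost, which agrees with the word RAM up to polylogarithmic factors). SETH is the hypothesis that CNF-SAT on $N$ variables and $O(N)$ clauses requires $2^{N-o(N)}$ time; that is, for every $\varepsilon'>0$ there is a $C$ such that no algorithm decides the satisfiability of CNF formulas with $N$ variables and at most $CN$ clauses in time $O(2^{(1-\varepsilon')N})$. An $\alpha$-approximation of the diameter $D$ of a graph is a nonnegative integer $\hat D$ with $D\le\alpha\hat D$ and $\hat D\le D$. Assume SETH. Then for every $\varepsilon>0$, a $\left(\frac95-\varepsilon\right)$-approximation of the diameter of undirected unweighted graphs on $n$ vertices needs $n^{5/4-o(1)}$ time, even on sparse connected graphs. That is, for all $\varepsilon,\delta,\eta>0$, there is no algorithm that, for all $n$, given the edge list of any connected undirected unweighted graph with $n$ vertices and at most $n^{1+\eta}$ edges, outputs a $\left(\frac95-\varepsilon\right)$-approximation of its diameter in time $O(n^{5/4-\delta})$. (There is in particular no algorithm that does this in time $O(n^{5/4-\delta})$, or in time $O(m^{5/4-\delta})$ with $m$ the number of edges, on all connected graphs.) -/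

import Mathlib

/-! ### A random access machine with logarithmic cost

Memory consists of scalar registers and of arrays of unbounded length, all of whose cells hold
natural numbers. A program is a finite text, so it names only finitely many registers and arrays.
Every number that is read, computed, stored or used as an address is charged its bit length
(plus one), so that one unit of time never pays for more than one bit of work.
Up to factors polylogarithmic in the running time and the input length this is the same cost as
on a word RAM. -/

namespace RAM

/-- The contents of the memory: register `i` holds `reg i`, and cell `j` of array `k` holds
`arr k j`. -/
structure State where
  reg : ℕ → ℕ
  arr : ℕ → ℕ → ℕ

/-- The arithmetic operations of the machine. -/
inductive Op where
  | add
  | sub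
  | mul
  | div

/-- Subtraction is truncated at zero, division is rounded down, and dividing by zero gives zero. -/
def Op.eval : Op → ℕ → ℕ → ℕ
  | .add, a, b => a + b
  | .sub, a, b => a - b
  | .mul, a, b => a * b
  | .div, a, b => a / b

/-- Expressions: constants, registers, array cells `k[e]`, arithmetic. -/
inductive Expr where
  | const (c : ℕ)
  | reg (i : ℕ)
  | get (k : ℕ) (e : Expr)
  | op (o : Op) (a b : Expr)

/-- The value of an expression. -/
def Expr.eval (s : State) : Expr → ℕ
  | .const c => c
  | .reg i => s.reg i
  | .get k e => s.arr k (e.eval s)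
  | .op o a b => o.eval (a.eval s) (b.eval s)

/-- The cost of evaluating an expression: for every subexpression, one plus the bit length of its
value. -/
def Expr.cost (s : State) : Expr → ℕ
  | .const c => c.size + 1
  | .reg i => (s.reg i).size + 1
  | .get k e => e.cost s + (s.arr k (e.eval s)).size + 1
  | .op o a b => a.cost s + b.cost s + (o.eval (a.eval s) (b.eval s)).size + 1

/-- Programs. `assign i e` puts `e` into register `i`; `store k a e` puts `e` into cell `a` of
array `k`; `branch c p q` runs `p` if `c` is nonzero and `q` otherwise; `loop c p` repeats `p` as
long as `c` is nonzero. -/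
inductive Prog where
  | skip
  | assign (i : ℕ) (e : Expr)
  | store (k : ℕ) (a e : Expr)
  | seq (p q : Prog)
  | branch (c : Expr) (p q : Prog)
  | loop (c : Expr) (p : Prog)

/-- The state after writing `v` into register `i`. -/
def State.setReg (s : State) (i v : ℕ) : State where
  reg := Function.update s.reg i v
  arr := s.arr

/-- The state after writing `v` into cell `j` of array `k`. -/
def State.setArr (s : State) (k j v : ℕ) : State where
  reg := s.reg
  arr := Function.update s.arr k (Function.update (s.arr k) j v)

/-- `Exec p s t s'`: program `p`, started in state `s`, halts in state `s'` after time `t`. -/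
inductive Exec : Prog → State → ℕ → State → Prop where
  | skip (s : State) : Exec .skip s 1 s
  | assign (i : ℕ) (e : Expr) (s : State) :
      Exec (.assign i e) s (e.cost s + 1) (s.setReg i (e.eval s))
  | store (k : ℕ) (a e : Expr) (s : State) :
      Exec (.store k a e) s (a.cost s + e.cost s + 1) (s.setArr k (a.eval s) (e.eval s))
  | seq {p q : Prog} {s s' s'' : State} {t t' : ℕ} :
      Exec p s t s' → Exec q s' t' s'' → Exec (.seq p q) s (t + t') s''
  | branch_pos {c : Expr} {p q : Prog} {s s' : State} {t : ℕ} :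
      c.eval s ≠ 0 → Exec p s t s' → Exec (.branch c p q) s (c.cost s + 1 + t) s'
  | branch_zero {c : Expr} {p q : Prog} {s s' : State} {t : ℕ} :
      c.eval s = 0 → Exec q s t s' → Exec (.branch c p q) s (c.cost s + 1 + t) s'
  | loop_pos {c : Expr} {p : Prog} {s s' s'' : State} {t t' : ℕ} :
      c.eval s ≠ 0 → Exec p s t s' → Exec (.loop c p) s' t' s'' →
        Exec (.loop c p) s (c.cost s + 1 + t + t') s''
  | loop_zero {c : Expr} {p : Prog} {s : State} :
      c.eval s = 0 → Exec (.loop c p) s (c.cost s + 1) s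

/-- At the start the input stands in array `0`, its length in register `0`, and everything else
is zero. -/
def start (input : List ℕ) : State where
  reg i := if i = 0 then input.length else 0
  arr k j := if k = 0 then input.getD j 0 else 0

/-- On the given input, the program halts after time `t`, with the number `out` in register `0`. -/
def HaltsWith (p : Prog) (input : List ℕ) (t out : ℕ) : Prop :=
  ∃ s : State, Exec p (start input) t s ∧ s.reg 0 = out

end RAM

/-! ### Satisfiability and the Strong Exponential Time Hypothesis -/

/-- CNF formulas in the variables `x_0, …, x_{n-1}`: lists of clauses, which are lists of literals;
the literal `(i, true)` is `x_i` and `(i, false)` is its negation. -/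
abbrev CNF (n : ℕ) := List (List (Fin n × Bool))

/-- Some assignment makes a literal of every clause true. -/
def CNF.Satisfiable {n : ℕ} (φ : CNF n) : Prop :=
  ∃ v : Fin n → Bool, ∀ c ∈ φ, ∃ l ∈ c, v l.1 = l.2

/-- A formula as an input: the number of variables, the number of clauses, and then, for each
clause, its length and its literals, where `(i, b)` is coded by `2 * i + b`. -/
def CNF.encode {n : ℕ} (φ : CNF n) : List ℕ :=
  n :: φ.length ::
    φ.flatMap fun c => c.length :: c.map fun l => 2 * (l.1 : ℕ) + (if l.2 then 1 else 0)

/-- The program decides, in time at most `T n`, the satisfiability of the CNF formulas with `n`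
variables and at most `C * n` clauses (no literal being repeated within a clause). A nonzero output
means "satisfiable". -/
def DecidesCNFSat (p : RAM.Prog) (C : ℕ) (T : ℕ → ℝ) : Prop :=
  ∀ (n : ℕ) (φ : CNF n), φ.length ≤ C * n → (∀ c ∈ φ, c.Nodup) →
    ∃ t out : ℕ, RAM.HaltsWith p φ.encode t out ∧ (t : ℝ) ≤ T n ∧ (out ≠ 0 ↔ φ.Satisfiable)

/-- The Strong Exponential Time Hypothesis: CNF-SAT with `n` variables and `O(n)` clauses requires
time `2 ^ (n - o(n))`. That is, for every `ε > 0` there is a clause density `C` for which no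
algorithm runs in time `O(2 ^ ((1 - ε) * n))`. -/
def SETH : Prop :=
  ∀ ε : ℝ, 0 < ε → ∃ C : ℕ, ∀ (p : RAM.Prog) (K : ℝ),
    ¬ DecidesCNFSat p C (fun n => K * (2 : ℝ) ^ ((1 - ε) * (n : ℝ)))

/-! ### Approximating the diameter -/

/-- `E` lists every edge of the graph exactly once, in any order and with either orientation. -/
def IsEdgeList {n : ℕ} (G : SimpleGraph (Fin n)) (E : List (Fin n × Fin n)) : Prop :=
  (E.map fun e => s(e.1, e.2)).Nodup ∧
    ∀ u v : Fin n, s(u, v) ∈ E.map (fun e => s(e.1, e.2)) ↔ G.Adj u v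

/-- A graph as an input: the number of vertices, the number of edges, and the edge list. -/
def encodeGraph (n : ℕ) (E : List (Fin n × Fin n)) : List ℕ :=
  n :: E.length :: E.flatMap fun e => [(e.1 : ℕ), (e.2 : ℕ)]

/-- `D'` is an `α`-approximation of `D`: `D / α ≤ D' ≤ D`, written without division. -/
def IsApprox (α : ℝ) (D D' : ℕ) : Prop :=
  (D : ℝ) ≤ α * (D' : ℝ) ∧ D' ≤ D

/-- The program computes, in time at most `T n`, an `α`-approximation of the diameter of every
connected undirected unweighted graph with `n` vertices and at most `M n` edges, given by any of its
edge lists. -/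
def ApproximatesDiameter (p : RAM.Prog) (α : ℝ) (M T : ℕ → ℝ) : Prop :=
  ∀ (n : ℕ) (G : SimpleGraph (Fin n)) (E : List (Fin n × Fin n)),
    G.Connected → IsEdgeList G E → (E.length : ℝ) ≤ M n →
      ∃ t out : ℕ, RAM.HaltsWith p (encodeGraph n E) t out ∧ (t : ℝ) ≤ T n ∧
        IsApprox α G.diam out

/-! ### The graph of stacks -/

/-! Split the variables into five blocks of length `b` and take as vectors the `5 * 2 ^ b`
assignments to single blocks. The coordinates are the clauses and five extra ones; a vector has
zeros at the clauses it satisfies and at the extra coordinate of its own block. Five vectors without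
a common one must then come from five different blocks, so they exist exactly if the formula is
satisfiable (`not_noOrthogonal_of_satisfiable`, `satisfiable_of_not_noOrthogonal`). Any four vectors
do have a common one, at the coordinate of a block they miss (`generic`).

The graph has diameter at most 5 if any five vectors have a common one, and at least 9 otherwise.
The top layer consists of quadruples of vectors; most vertices below carry fewer vectors and an
array of six coordinates. Passing between quadruples, triples and splits, or exchanging vectors of a
split, is allowed only while the array satisfies the stacks concerned. The conditions `sat1` to
`sat4` are designed so that an array satisfying two stacks of sizes 4 and 1, or 3 and 2, exhibits a
common one of these five vectors, while common ones of all quintuples yield an array satisfying two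
given quadruples at once. With that array fixed, quadruple, triple, split, split, triple, quadruple
is a path of length 5 (`near_five`). If `a, b, c, e, f` have no common one, the balls of radius 4
around `(a, b, c, e)` and `(f, e, c, b)` are disjoint (`ballSup_disjoint`), so these vertices are at
distance at least 9.

A factor below 9/5 separates 5 from 9, so an approximation decides satisfiability (`decide_halts`).
At fixed clause density the graph has `2 ^ (4 * n / 5)` vertices and edges up to factors polynomial
in `n`. The power `5 / 4 - δ` of this is exponentially smaller than `2 ^ n`, contrary to SETH. The
reduction itself is a machine program: it tabulates the vectors, enumerates all possible edges by
arithmetic formulas, and leaves the edge list where the given program, moved to fresh memory, finds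
it as its input. -/

/-- Stacks of one to four vectors of `A` that are satisfied by an array of `X`. -/
structure StackSystem (A X : Type) where
  s1 : A → X → Prop
  s2 : A → A → X → Prop
  s3 : A → A → A → X → Prop
  s4 : A → A → A → A → X → Prop
  s1_of_s2 : ∀ {a b x}, s2 a b x → s1 a x
  s2_of_s3 : ∀ {a b c x}, s3 a b c x → s2 a b x
  s3_of_s4 : ∀ {a b c d x}, s4 a b c d x → s3 a b c x

/-- The vertices of the graph of stacks. -/
inductive StackVertex (A X : Type)
  | quad (a b c d : A)
  | triple (a b c : A) (x : X)
  | split (a b r : A) (x : X)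
  | pair (a b : A) (x : X)
  | hub (a b : A)

namespace StackSystem

variable {A X : Type} (σ : StackSystem A X)

open StackVertex

/-- The edges of the graph of stacks, each with one or both of its orientations. -/
inductive Edge : StackVertex A X → StackVertex A X → Prop
  | quad_triple {a b c d x} : σ.s4 a b c d x → Edge (quad a b c d) (triple a b c x)
  | triple_triple {a b c x y} : Edge (triple a b c x) (triple a b c y)
  | triple_split {a b c r x} : σ.s3 a b c x → σ.s1 r x → Edge (triple a b c x) (split a b r x)
  | turn {a b r e x} : σ.s2 a b x → σ.s2 r e x → Edge (split a b r x) (split r e a x)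
  | swap {a b r s x} : σ.s2 a b x → σ.s1 r x → σ.s1 s x → Edge (split a b r x) (split a b s x)
  | split_split {a b r x y} : Edge (split a b r x) (split a b r y)
  | split_pair {a b r x} : Edge (split a b r x) (pair a b x)
  | pair_pair {a b x y} : Edge (pair a b x) (pair a b y)
  | pair_hub {a b x} : Edge (pair a b x) (hub a b)
  | hub_hub {a b c d} : Edge (hub a b) (hub c d)

/-- The graph of stacks. -/
def graph : SimpleGraph (StackVertex A X) := SimpleGraph.fromRel σ.Edge

/-- There is a walk of length at most `k`. -/
def Near (k : ℕ) (u v : StackVertex A X) : Prop := ∃ w : σ.graph.Walk u v, w.length ≤ k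

variable {σ}

lemma adj_iff {u v : StackVertex A X} :
    σ.graph.Adj u v ↔ u ≠ v ∧ (σ.Edge u v ∨ σ.Edge v u) :=
  SimpleGraph.fromRel_adj _ _ _

lemma Edge.near {u v : StackVertex A X} (h : σ.Edge u v) : σ.Near 1 u v := by
  by_cases huv : u = v
  · subst huv; exact ⟨.nil, by simp⟩
  · exact ⟨.cons (adj_iff.2 ⟨huv, .inl h⟩) .nil, by simp⟩

lemma Near.symm {k : ℕ} {u v : StackVertex A X} : σ.Near k u v → σ.Near k v u := by
  rintro ⟨w, hw⟩; exact ⟨w.reverse, by simpa using hw⟩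

lemma Near.trans {j k : ℕ} {u v w : StackVertex A X} :
    σ.Near j u v → σ.Near k v w → σ.Near (j + k) u w := by
  rintro ⟨p, hp⟩ ⟨q, hq⟩; exact ⟨p.append q, by simp; omega⟩

lemma Near.mono {j k : ℕ} {u v : StackVertex A X} (h : σ.Near j u v) (hjk : j ≤ k) :
    σ.Near k u v := by
  obtain ⟨w, hw⟩ := h; exact ⟨w, hw.trans hjk⟩

/-- The array satisfies both stacks, so it stays fixed while the leading pair turns from `a, b` to
`p, q`; `a` survives as the single vector of the split. -/
lemma near_turn {a b c p q x} (h3 : σ.s3 a b c x) (h2 : σ.s2 p q x) :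
    σ.Near 2 (triple a b c x) (split p q a x) :=
  (Edge.triple_split h3 (σ.s1_of_s2 h2)).near.trans (Edge.turn (σ.s2_of_s3 h3) h2).near

lemma near_triple_triple {a b c p q r x} (h : σ.s3 a b c x) (h' : σ.s3 p q r x) :
    σ.Near 3 (triple a b c x) (triple p q r x) :=
  (near_turn h (σ.s2_of_s3 h')).trans
    (Edge.triple_split h' (σ.s1_of_s2 (σ.s2_of_s3 h))).near.symm

/-- After the turn the single vector is `a`; one swap replaces it by `r`, and the array is exchanged
last. -/
lemma near_swap {a b c p q r x y} (h : σ.s3 a b c x) (h' : σ.s2 p q x) (hr : σ.s1 r x) :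
    σ.Near 4 (triple a b c x) (split p q r y) :=
  ((near_turn h h').trans (Edge.swap h' (σ.s1_of_s2 (σ.s2_of_s3 h)) hr).near).trans
    Edge.split_split.near

/-- The hubs form a clique, so splits, pairs and hubs are close to each other whatever their arrays
satisfy. -/
lemma near_pair_hub {a b p q x} : σ.Near 2 (pair a b x) (hub p q) :=
  Edge.pair_hub.near.trans Edge.hub_hub.near

lemma near_pair_pair {a b p q x y} : σ.Near 3 (pair a b x) (pair p q y) :=
  near_pair_hub.trans Edge.pair_hub.near.symm

/-- If any two stacks are satisfied by a common array, then all distances are at most five. -/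
theorem near_five
    (h₁ : ∀ a b c d p q r s, ∃ x, σ.s4 a b c d x ∧ σ.s4 p q r s x)
    (h₂ : ∀ a b c d p q r, ∃ x, σ.s4 a b c d x ∧ σ.s2 p q x ∧ σ.s1 r x)
    (u v : StackVertex A X) : σ.Near 5 u v := by
  have qt : ∀ {a b c d p q r y}, σ.Near 5 (quad a b c d) (triple p q r y) := by
    intro a b c d p q r y
    -- A shorter stack is padded by repeating a vector, here and below.
    obtain ⟨x, h, h'⟩ := h₁ a b c d p q r r
    exact ((Edge.quad_triple h).near.trans
      (near_triple_triple (σ.s3_of_s4 h) (σ.s3_of_s4 h'))).trans Edge.triple_triple.near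
  have qs : ∀ {a b c d p q r y}, σ.Near 5 (quad a b c d) (split p q r y) := by
    intro a b c d p q r y
    obtain ⟨x, h, h', h''⟩ := h₂ a b c d p q r
    exact (Edge.quad_triple h).near.trans (near_swap (σ.s3_of_s4 h) h' h'')
  have qc : ∀ {a b c d p q y}, σ.Near 5 (quad a b c d) (pair p q y) := by
    intro a b c d p q y
    obtain ⟨x, h, h', -⟩ := h₂ a b c d p q p
    exact (((Edge.quad_triple h).near.trans (near_turn (σ.s3_of_s4 h) h')).trans
      Edge.split_pair.near).trans Edge.pair_pair.near
  have qh : ∀ {a b c d p q}, σ.Near 5 (quad a b c d) (hub p q) := by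
    intro a b c d p q
    obtain ⟨x, h, h', -⟩ := h₂ a b c d p q p
    exact (((Edge.quad_triple h).near.trans (near_turn (σ.s3_of_s4 h) h')).trans
      Edge.split_pair.near).trans Edge.pair_hub.near
  have ts : ∀ {a b c z p q r y}, σ.Near 5 (triple a b c z) (split p q r y) := by
    intro a b c z p q r y
    obtain ⟨x, h, h', h''⟩ := h₂ a b c c p q r
    exact Edge.triple_triple.near.trans (near_swap (σ.s3_of_s4 h) h' h'')
  have tp : ∀ {a b c z p q y}, σ.Near 5 (triple a b c z) (pair p q y) := by
    intro a b c z p q y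
    obtain ⟨x, h, h', -⟩ := h₂ a b c c p q p
    exact ((Edge.triple_triple.near.trans (near_turn (σ.s3_of_s4 h) h')).trans
      Edge.split_pair.near).trans Edge.pair_pair.near
  have th : ∀ {a b c z p q}, σ.Near 5 (triple a b c z) (hub p q) := by
    intro a b c z p q
    obtain ⟨x, h, h', -⟩ := h₂ a b c c p q p
    exact ((Edge.triple_triple.near.trans (near_turn (σ.s3_of_s4 h) h')).trans
      Edge.split_pair.near).trans Edge.pair_hub.near
  have sp : ∀ {a b r x p q y}, σ.Near 4 (split a b r x) (pair p q y) :=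
    Edge.split_pair.near.trans near_pair_pair
  have sh : ∀ {a b r x p q}, σ.Near 3 (split a b r x) (hub p q) :=
    Edge.split_pair.near.trans near_pair_hub
  cases u <;> cases v
  case quad.quad a b c d p q r s =>
    obtain ⟨x, h, h'⟩ := h₁ a b c d p q r s
    exact ((Edge.quad_triple h).near.trans
      (near_triple_triple (σ.s3_of_s4 h) (σ.s3_of_s4 h'))).trans (Edge.quad_triple h').near.symm
  case triple.triple a b c x' p q r y =>
    obtain ⟨x, h, h'⟩ := h₁ a b c c p q r r
    exact (Edge.triple_triple.near.trans
      (near_triple_triple (σ.s3_of_s4 h) (σ.s3_of_s4 h'))).trans Edge.triple_triple.near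
  case quad.triple => exact qt
  case triple.quad => exact qt.symm
  case quad.split => exact qs
  case split.quad => exact qs.symm
  case quad.pair => exact qc
  case pair.quad => exact qc.symm
  case quad.hub => exact qh
  case hub.quad => exact qh.symm
  case triple.split => exact ts
  case split.triple => exact ts.symm
  case triple.pair => exact tp
  case pair.triple => exact tp.symm
  case triple.hub => exact th
  case hub.triple => exact th.symm
  case split.split => exact sp.trans Edge.split_pair.near.symm
  case split.pair => exact sp.mono (by simp)
  case pair.split => exact sp.symm.mono (by simp)
  case split.hub => exact sh.mono (by simp)
  case hub.split => exact sh.symm.mono (by simp)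
  case pair.pair => exact near_pair_pair.mono (by simp)
  case pair.hub => exact near_pair_hub.mono (by simp)
  case hub.pair => exact near_pair_hub.symm.mono (by simp)
  case hub.hub => exact Edge.hub_hub.near.mono (by simp)

/-- If every stack is satisfied by some array, then the graph is connected. -/
theorem graph_connected [Nonempty A] (h : ∀ a b c d, ∃ x, σ.s4 a b c d x) :
    σ.graph.Connected := by
  obtain ⟨o⟩ := ‹Nonempty A›
  have key : ∀ u : StackVertex A X, ∃ k, σ.Near k u (hub o o) := by
    have ht : ∀ a b c z, ∃ k, σ.Near k (triple a b c z) (hub o o) := fun a b c z => by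
      obtain ⟨x, hx⟩ := h a b c c
      have h3 := σ.s3_of_s4 hx
      exact ⟨_, (Edge.triple_triple.near.trans (near_turn h3 (σ.s2_of_s3 h3))).trans
        (Edge.split_pair.near.trans near_pair_hub)⟩
    rintro (⟨a, b, c, d⟩ | ⟨a, b, c, x⟩ | ⟨a, b, r, x⟩ | ⟨a, b, x⟩ | ⟨a, b⟩)
    · obtain ⟨x, hx⟩ := h a b c d
      obtain ⟨k, hk⟩ := ht a b c x
      exact ⟨_, (Edge.quad_triple hx).near.trans hk⟩
    · exact ht a b c x
    · exact ⟨_, Edge.split_pair.near.trans near_pair_hub⟩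
    · exact ⟨_, near_pair_hub⟩
    · exact ⟨_, Edge.hub_hub.near⟩
  have : Nonempty (StackVertex A X) := ⟨hub o o⟩
  refine ⟨fun u v => ?_⟩
  obtain ⟨-, w, -⟩ := key u
  obtain ⟨-, w', -⟩ := key v
  exact ⟨w.append w'.reverse⟩

/-! ### The lower bound nine: balls of radius four -/

/-- A superset of the ball of radius `k` around `quad a b c d`, for `k ≤ 4`. -/
def ballSup (σ : StackSystem A X) (a b c d : A) : ℕ → StackVertex A X → Prop
  | 0, v => v = quad a b c d
  | 1, .quad a' b' c' d' => a' = a ∧ b' = b ∧ c' = c ∧ d' = d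
  | 1, .triple a' b' c' x => a' = a ∧ b' = b ∧ c' = c ∧ σ.s4 a b c d x
  | 2, .quad a' b' c' _ => a' = a ∧ b' = b ∧ c' = c
  | 2, .triple a' b' c' _ => a' = a ∧ b' = b ∧ c' = c
  | 2, .split a' b' r x => a' = a ∧ b' = b ∧ σ.s4 a b c d x ∧ σ.s1 r x
  | 3, .quad a' b' c' _ => a' = a ∧ b' = b ∧ c' = c
  | 3, .triple a' b' c' x => a' = a ∧ b' = b ∧ (c' = c ∨ σ.s4 a b c d x ∧ σ.s3 a b c' x)
  | 3, .split a' b' r y => a' = a ∧ b' = b ∧ (σ.s3 a b c y ∨ ∃ x, σ.s4 a b c d x ∧ σ.s1 r x) ∨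
      r = a ∧ σ.s4 a b c d y ∧ σ.s2 a' b' y
  | 3, .pair a' b' _ => a' = a ∧ b' = b
  -- In every alternative the leading pair is still `a, b`, or `a` survives as the single vector, or
  -- the array satisfies the whole quadruple. The further clauses record what is needed to
  -- contradict membership in a second ball.
  | 4, .quad a' b' _ _ => a' = a ∧ b' = b
  | 4, .triple a' b' c' x => a' = a ∧ b' = b ∨ σ.s4 a b c d x ∧ σ.s3 a' b' c' x
  | 4, .split a' b' r y => a' = a ∧ b' = b ∨
      r = a ∧ σ.s2 a b y ∧ σ.s2 a' b' y ∧ (σ.s3 a b c y ∨ ∃ x, σ.s4 a b c d x ∧ σ.s1 a' x) ∨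
      σ.s4 a b c d y ∧ σ.s2 a' b' y ∧ σ.s1 r y ∨
      r = a ∧ ∃ x, σ.s4 a b c d x ∧ σ.s2 a' b' x
  | 4, .pair a' b' x => a' = a ∧ b' = b ∨ σ.s4 a b c d x ∧ σ.s2 a' b' x
  | 4, .hub a' b' => a' = a ∧ b' = b
  | _, _ => False

lemma ballSup_zero {a b c d u v} (hu : σ.ballSup a b c d 0 u) (h : σ.Edge u v ∨ σ.Edge v u) :
    σ.ballSup a b c d 1 v := by
  have := @σ.s1_of_s2; have := @σ.s2_of_s3; have := @σ.s3_of_s4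
  rcases h with h | h <;> cases h <;> simp_all [ballSup]

lemma ballSup_one {a b c d u v} (hu : σ.ballSup a b c d 1 u) (h : σ.Edge u v ∨ σ.Edge v u) :
    σ.ballSup a b c d 2 v := by
  have := @σ.s1_of_s2; have := @σ.s2_of_s3; have := @σ.s3_of_s4
  rcases h with h | h <;> cases h <;> simp only [ballSup] at hu ⊢ <;> grind

lemma ballSup_two {a b c d u v} (hu : σ.ballSup a b c d 2 u) (h : σ.Edge u v ∨ σ.Edge v u) :
    σ.ballSup a b c d 3 v := by
  have := @σ.s1_of_s2; have := @σ.s2_of_s3; have := @σ.s3_of_s4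
  rcases h with h | h <;> cases h <;> simp only [ballSup] at hu ⊢ <;> grind

lemma ballSup_three {a b c d u v} (hu : σ.ballSup a b c d 3 u) (h : σ.Edge u v ∨ σ.Edge v u) :
    σ.ballSup a b c d 4 v := by
  have := @σ.s1_of_s2; have := @σ.s2_of_s3; have := @σ.s3_of_s4
  rcases h with h | h <;> cases h <;> simp only [ballSup] at hu ⊢ <;> grind

lemma ballSup_succ {a b c d u} {k : ℕ} (hk : k < 4) (hu : σ.ballSup a b c d k u) :
    σ.ballSup a b c d (k + 1) u := by
  have := @σ.s1_of_s2; have := @σ.s2_of_s3; have := @σ.s3_of_s4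
  interval_cases k <;> cases u <;> simp only [ballSup] at hu ⊢ <;> grind

/-- Each set contains the previous one and its neighbours; the level `i` makes the induction along
the walk possible. -/
lemma ballSup_of_walk {a b c d u v} (w : σ.graph.Walk u v) {i : ℕ} (hi : i + w.length ≤ 4)
    (hu : σ.ballSup a b c d i u) : σ.ballSup a b c d 4 v := by
  induction w generalizing i with
  | nil =>
    rw [SimpleGraph.Walk.length_nil] at hi
    obtain ⟨j, hj⟩ : ∃ j, i + j = 4 := ⟨4 - i, by omega⟩
    induction j generalizing i with
    | zero => obtain rfl : i = 4 := by omega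
              exact hu
    | succ j ih => exact ih (i := i + 1) (by omega) (ballSup_succ (by omega) hu) (by omega)
  | cons h w ih =>
    rw [SimpleGraph.Walk.length_cons] at hi
    refine ih (i := i + 1) (by omega) ?_
    have h := (adj_iff.1 h).2
    have : i < 4 := by omega
    interval_cases i
    · exact ballSup_zero hu h
    · exact ballSup_one hu h
    · exact ballSup_two hu h
    · exact ballSup_three hu h

/-- A vertex in both sets would give `a = p`, or an array, its own or one passed on the way, that
satisfies initial parts of both stacks with five vectors together, against one of `h₁` to `h₄`. -/
lemma ballSup_disjoint {a b c d p q r s : A} (hne : a ≠ p)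
    (h₁ : ∀ x, σ.s4 a b c d x → ¬ σ.s1 p x) (h₂ : ∀ x, σ.s3 a b c x → ¬ σ.s2 p q x)
    (h₃ : ∀ x, σ.s2 a b x → ¬ σ.s3 p q r x) (h₄ : ∀ x, σ.s1 a x → ¬ σ.s4 p q r s x)
    {v : StackVertex A X} (hv : σ.ballSup a b c d 4 v) : ¬ σ.ballSup p q r s 4 v := by
  intro hv'
  have := @σ.s1_of_s2; have := @σ.s2_of_s3; have := @σ.s3_of_s4
  cases v <;> simp only [ballSup] at hv hv' <;> grind

/-- Two stacks without common arrays, in the sense of the hypotheses, are at distance at least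
nine. -/
theorem nine_le_length {a b c d p q r s : A} (hne : a ≠ p)
    (h₁ : ∀ x, σ.s4 a b c d x → ¬ σ.s1 p x) (h₂ : ∀ x, σ.s3 a b c x → ¬ σ.s2 p q x)
    (h₃ : ∀ x, σ.s2 a b x → ¬ σ.s3 p q r x) (h₄ : ∀ x, σ.s1 a x → ¬ σ.s4 p q r s x)
    (w : σ.graph.Walk (quad a b c d) (quad p q r s)) : 9 ≤ w.length := by
  by_contra! hw
  -- The fourth vertex of a walk of length at most eight is within distance four of both ends.
  refine ballSup_disjoint hne h₁ h₂ h₃ h₄ (v := w.getVert 4)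
    (ballSup_of_walk (w.take 4) (i := 0) ?_ rfl) (ballSup_of_walk (w.drop 4).reverse (i := 0) ?_ rfl)
  · simp
  · simp; omega

end StackSystem

/-- Transporting bounds on walks to a bound on the diameter. -/
lemma SimpleGraph.Iso.diam_le {V W : Type} [Finite V] {G : SimpleGraph V} {H : SimpleGraph W}
    (f : G ≃g H) {k : ℕ} (h : ∀ u v, ∃ w : H.Walk u v, w.length ≤ k) : G.diam ≤ k := by
  have : G.ediam ≤ k := SimpleGraph.ediam_le_of_edist_le fun u v => by
    obtain ⟨w, hw⟩ := h (f u) (f v)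
    have := (((w.map f.symm.toHom).copy (f.symm_apply_apply u) (f.symm_apply_apply v))).edist_le
    refine this.trans ?_
    simpa using hw
  exact ENat.toNat_le_of_le_natCast this

lemma SimpleGraph.Iso.le_diam {V W : Type} [Finite V] {G : SimpleGraph V} {H : SimpleGraph W}
    (f : G ≃g H) (hG : G.Connected) {k : ℕ} {u v : W} (h : ∀ w : H.Walk u v, k ≤ w.length) :
    k ≤ G.diam := by
  have := hG.nonempty
  obtain ⟨w, hw⟩ := hG.exists_walk_length_eq_dist (f.symm u) (f.symm v)
  have h1 := h ((w.map f.toHom).copy (f.apply_symm_apply u) (f.apply_symm_apply v))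
  have h2 : G.dist (f.symm u) (f.symm v) ≤ G.diam :=
    SimpleGraph.dist_le_diam (SimpleGraph.connected_iff_ediam_ne_top.1 hG)
  simp at h1
  omega

/-! ### Arithmetic formulas for the reduction, read in `ℕ` or as expressions of the machine -/

/-- The numbers of vectors, of coordinates and of arrays, and the table of the zero entries of the
vectors. -/
structure Layout (α : Type) where
  M : α
  d : α
  D : α
  look : α → α

namespace Layout

section Formulas

variable {α : Type} [Add α] [Sub α] [Mul α] [Div α] [One α] (L : Layout α)

/-- The remainder of a division. -/
def rem (a b : α) : α := a - a / b * b

/-- One if `z` is zero, else zero. -/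
def isZero (z : α) : α := 1 - z

/-- Coordinate `c` of vector `a`. -/
def bit (a c : α) : α := 1 - L.look (a * L.d + c)

/-- Entry `i` of the array `x`. -/
def entry : ℕ → α → α
  | 0, x => rem x L.d
  | i + 1, x => entry i (x / L.d)

/-- The coordinate of `a` that stands at place `i` of the array `x`. -/
def at1 (i : ℕ) (a x : α) : α := L.bit a (L.entry i x)
def at2 (i : ℕ) (a b x : α) : α := L.at1 i a x * L.at1 i b x
def at3 (i : ℕ) (a b c x : α) : α := L.at2 i a b x * L.at1 i c x
def at4 (i : ℕ) (a b c e x : α) : α := L.at3 i a b c x * L.at1 i e x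

/-- The stack `a` is satisfied by `x`. -/
def sat1 (a x : α) : α := (L.at1 0 a x + L.at1 1 a x) * (L.at1 3 a x + L.at1 4 a x)
-- The places 0, 1, 2 and 3, 4, 5 form two halves. A single vector needs a one among the first two
-- places of each half and a pair a shared one in each half; a triple must have ones throughout some
-- half, a quadruple at the first two places of some half. Thus a quadruple meets a single vector,
-- and a triple meets a pair, whichever half was chosen. Each condition contains the previous one so
-- that it passes to initial parts.
def sat2 (a b x : α) : α :=
  L.sat1 a x * ((L.at2 0 a b x + L.at2 1 a b x + L.at2 2 a b x) *
    (L.at2 3 a b x + L.at2 4 a b x + L.at2 5 a b x))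
def sat3 (a b c x : α) : α :=
  L.sat2 a b x * (L.at3 0 a b c x * L.at3 1 a b c x * L.at3 2 a b c x +
    L.at3 3 a b c x * L.at3 4 a b c x * L.at3 5 a b c x)
def sat4 (a b c e x : α) : α :=
  L.sat3 a b c x * (L.at4 0 a b c e x * L.at4 1 a b c e x + L.at4 3 a b c e x * L.at4 4 a b c e x)

/-- The numbers of the vertices. -/
def quad (a b c e : α) : α := ((a * L.M + b) * L.M + c) * L.M + e
def triple (a b c x : α) : α := L.M * L.M * L.M * L.M + (((a * L.M + b) * L.M + c) * L.D + x)
def split (a b r x : α) : α :=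
  L.M * L.M * L.M * L.M + (L.M * L.M * L.M * L.D + (((a * L.M + b) * L.M + r) * L.D + x))
def pair (a b x : α) : α :=
  L.M * L.M * L.M * L.M + (L.M * L.M * L.M * L.D + (L.M * L.M * L.M * L.D +
    ((a * L.M + b) * L.D + x)))
def hub (a b : α) : α :=
  L.M * L.M * L.M * L.M + (L.M * L.M * L.M * L.D + (L.M * L.M * L.M * L.D + (L.M * L.M * L.D +
    (a * L.M + b))))

/-- The number of vertices. -/
def size : α :=
  L.M * L.M * L.M * L.M + (L.M * L.M * L.M * L.D + (L.M * L.M * L.M * L.D + (L.M * L.M * L.D +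
    L.M * L.M)))

/-- The number of possible edges of each kind. -/
def total : α := L.M * L.M * L.M * L.M * L.D * L.D

/-- The condition for the presence of an edge of kind `j`, and its ends. -/
def kind (j : ℕ) (a b c e x y : α) : α × α × α :=
  match j with
  -- The factors `isZero` force the parameters that play no role in a kind to be zero, so that an
  -- edge does not arise from several choices of them.
  | 0 => (L.sat4 a b c e x * isZero y, L.quad a b c e, L.triple a b c x)
  | 1 => (isZero e, L.triple a b c x, L.triple a b c y)
  | 2 => (L.sat3 a b c x * L.sat1 e x * isZero y, L.triple a b c x, L.split a b e x)
  | 3 => (L.sat2 a b x * L.sat2 c e x * isZero y, L.split a b c x, L.split c e a x)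
  | 4 => (L.sat2 a b x * (L.sat1 c x * L.sat1 e x) * isZero y, L.split a b c x, L.split a b e x)
  | 5 => (isZero e, L.split a b c x, L.split a b c y)
  | 6 => (isZero e * isZero y, L.split a b c x, L.pair a b x)
  | 7 => (isZero c * isZero e, L.pair a b x, L.pair a b y)
  | 8 => (isZero c * isZero e * isZero y, L.pair a b x, L.hub a b)
  | _ => (isZero x * isZero y, L.hub a b, L.hub c e)

/-- The kind `j` with its parameters decoded from a single number. -/
def decoded (j : ℕ) (k : α) : α × α × α :=
  L.kind j (k / L.D / L.D / L.M / L.M / L.M) (rem (k / L.D / L.D / L.M / L.M) L.M)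
    (rem (k / L.D / L.D / L.M) L.M) (rem (k / L.D / L.D) L.M) (rem (k / L.D) L.D) (rem k L.D)

/-- The edge is present, and its first end has the smaller number. -/
def present (j : ℕ) (k : α) : α :=
  (L.decoded j k).1 * ((L.decoded j k).2.2 - (L.decoded j k).2.1)

end Formulas

end Layout

namespace RAM

instance : Add Expr := ⟨.op .add⟩
instance : Sub Expr := ⟨.op .sub⟩
instance : Mul Expr := ⟨.op .mul⟩
instance : Div Expr := ⟨.op .div⟩
instance : One Expr := ⟨.const 1⟩

@[simp] lemma Expr.eval_add (s : State) (a b : Expr) : (a + b).eval s = a.eval s + b.eval s := rfl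
@[simp] lemma Expr.eval_sub (s : State) (a b : Expr) : (a - b).eval s = a.eval s - b.eval s := rfl
@[simp] lemma Expr.eval_mul (s : State) (a b : Expr) : (a * b).eval s = a.eval s * b.eval s := rfl
@[simp] lemma Expr.eval_div (s : State) (a b : Expr) : (a / b).eval s = a.eval s / b.eval s := rfl
@[simp] lemma Expr.eval_one (s : State) : (1 : Expr).eval s = 1 := rfl
@[simp] lemma Expr.eval_const (s : State) (c : ℕ) : (Expr.const c).eval s = c := rfl
@[simp] lemma Expr.eval_reg (s : State) (i : ℕ) : (Expr.reg i).eval s = s.reg i := rfl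
@[simp] lemma Expr.eval_get (s : State) (k : ℕ) (e : Expr) :
    (Expr.get k e).eval s = s.arr k (e.eval s) := rfl

end RAM

namespace Layout

open RAM

/-- A layout of expressions, evaluated. -/
structure Evaluates (s : State) (L : Layout Expr) (L' : Layout ℕ) : Prop where
  M : L.M.eval s = L'.M
  d : L.d.eval s = L'.d
  D : L.D.eval s = L'.D
  look : ∀ e, (L.look e).eval s = L'.look (e.eval s)

variable {s : State} {L : Layout Expr} {L' : Layout ℕ}

lemma eval_rem (a b : Expr) : (rem a b).eval s = rem (a.eval s) (b.eval s) := rfl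

lemma eval_isZero (a : Expr) : (isZero a).eval s = isZero (a.eval s) := rfl

lemma Evaluates.bit (h : Evaluates s L L') (a c : Expr) :
    (L.bit a c).eval s = L'.bit (a.eval s) (c.eval s) := by
  simp [Layout.bit, h.look, h.d]

lemma Evaluates.entry (h : Evaluates s L L') (i : ℕ) (x : Expr) :
    (L.entry i x).eval s = L'.entry i (x.eval s) := by
  induction i generalizing x with
  | zero => simp [Layout.entry, eval_rem, h.d]
  | succ i ih => simp [Layout.entry, ih, h.d]

lemma Evaluates.at1 (h : Evaluates s L L') (i : ℕ) (a x : Expr) :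
    (L.at1 i a x).eval s = L'.at1 i (a.eval s) (x.eval s) := by
  simp [Layout.at1, h.bit, h.entry]

/-- One formula serves both readings: it uses only the arithmetic common to `Expr` and `ℕ` and the
fields of the layout, so evaluation commutes with it. -/
lemma Evaluates.kind (h : Evaluates s L L') (j : ℕ) (a b c e x y : Expr) :
    ((L.kind j a b c e x y).1.eval s, (L.kind j a b c e x y).2.1.eval s,
      (L.kind j a b c e x y).2.2.eval s) =
    L'.kind j (a.eval s) (b.eval s) (c.eval s) (e.eval s) (x.eval s) (y.eval s) := by
  unfold Layout.kind
  split <;> simp [sat1, sat2, sat3, sat4, at2, at3, at4, h.at1, h.M, h.D, quad, triple, split,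
    pair, hub, eval_isZero]

lemma Evaluates.decoded (h : Evaluates s L L') (j : ℕ) (k : Expr) :
    ((L.decoded j k).1.eval s, (L.decoded j k).2.1.eval s, (L.decoded j k).2.2.eval s) =
      L'.decoded j (k.eval s) := by
  unfold Layout.decoded
  rw [h.kind]
  simp [h.M, h.D, eval_rem]

lemma Evaluates.src (h : Evaluates s L L') (j : ℕ) (k : Expr) :
    (L.decoded j k).2.1.eval s = (L'.decoded j (k.eval s)).2.1 := by rw [← h.decoded]

lemma Evaluates.dst (h : Evaluates s L L') (j : ℕ) (k : Expr) :
    (L.decoded j k).2.2.eval s = (L'.decoded j (k.eval s)).2.2 := by rw [← h.decoded]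

lemma Evaluates.present (h : Evaluates s L L') (j : ℕ) (k : Expr) :
    (L.present j k).eval s = L'.present j (k.eval s) := by
  simp [Layout.present, ← h.decoded]

lemma Evaluates.size (h : Evaluates s L L') : L.size.eval s = L'.size := by
  simp [Layout.size, h.M, h.D]

lemma Evaluates.total (h : Evaluates s L L') : L.total.eval s = L'.total := by
  simp [Layout.total, h.M, h.D]

/-! ### The graph of a layout of numbers -/

variable (L : Layout ℕ)

lemma rem_eq_mod (a b : ℕ) : rem a b = a % b := by
  unfold rem
  have := Nat.div_add_mod' a b
  omega

lemma isZero_ne_zero {a : ℕ} : isZero a ≠ 0 ↔ a = 0 := by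
  unfold isZero; omega

/-- Arrays are the numbers below `d ^ 6`, and their entries are the digits in base `d`. -/
lemma exists_entries (hD : L.D = L.d * L.d * L.d * L.d * L.d * L.d) (c : ℕ → ℕ)
    (hc : ∀ i, c i < L.d) :
    ∃ x < L.D, ∀ i < 6, L.entry i x = c i := by
  have hd : 0 < L.d := (Nat.zero_le _).trans_lt (hc 0)
  have step : ∀ (N x c : ℕ), x < N → c < L.d → c + L.d * x < N * L.d := fun N x c hx h =>
    calc c + L.d * x < L.d + L.d * x := by omega
      _ = (x + 1) * L.d := by ring
      _ ≤ N * L.d := Nat.mul_le_mul_right _ hx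
  refine ⟨c 0 + L.d * (c 1 + L.d * (c 2 + L.d * (c 3 + L.d * (c 4 + L.d * c 5)))), ?_, ?_⟩
  · rw [hD]
    exact step _ _ _ (step _ _ _ (step _ _ _ (step _ _ _ (step _ _ _ (hc 5) (hc 4)) (hc 3)) (hc 2))
      (hc 1)) (hc 0)
  · intro i hi
    have hm : ∀ i y, (c i + L.d * y) % L.d = c i := fun i y => by
      rw [Nat.add_mul_mod_self_left, Nat.mod_eq_of_lt (hc i)]
    have hq : ∀ i y, (c i + L.d * y) / L.d = y := fun i y => by
      rw [Nat.add_mul_div_left _ _ hd, Nat.div_eq_of_lt (hc i), zero_add]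
    interval_cases i <;> simp [entry, rem_eq_mod, hm, hq, Nat.mod_eq_of_lt (hc 5)]

lemma entry_lt (hd : 0 < L.d) (i x : ℕ) : L.entry i x < L.d := by
  induction i generalizing x with
  | zero => rw [entry, rem_eq_mod]; exact Nat.mod_lt _ hd
  | succ i ih => exact ih _

/-- The vectors and arrays of a layout. -/
def system : StackSystem (Fin L.M) (Fin L.D) where
  s1 a x := L.sat1 a x ≠ 0
  s2 a b x := L.sat2 a b x ≠ 0
  s3 a b c x := L.sat3 a b c x ≠ 0
  s4 a b c e x := L.sat4 a b c e x ≠ 0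
  s1_of_s2 h := (mul_ne_zero_iff.1 h).1
  s2_of_s3 h := (mul_ne_zero_iff.1 h).1
  s3_of_s4 h := (mul_ne_zero_iff.1 h).1

/-- Vector `a` has a one at coordinate `c`. -/
def One (a c : ℕ) : Prop := L.look (a * L.d + c) = 0

lemma at1_ne_zero {i a x : ℕ} : L.at1 i a x ≠ 0 ↔ L.One a (L.entry i x) := isZero_ne_zero

lemma at2_ne_zero {i a b x : ℕ} :
    L.at2 i a b x ≠ 0 ↔ L.One a (L.entry i x) ∧ L.One b (L.entry i x) := by
  simp only [at2, mul_ne_zero_iff, at1_ne_zero]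

lemma at3_ne_zero {i a b c x : ℕ} :
    L.at3 i a b c x ≠ 0 ↔ L.One a (L.entry i x) ∧ L.One b (L.entry i x) ∧
      L.One c (L.entry i x) := by
  simp only [at3, mul_ne_zero_iff, at1_ne_zero, at2_ne_zero, and_assoc]

lemma at4_ne_zero {i a b c e x : ℕ} :
    L.at4 i a b c e x ≠ 0 ↔ L.One a (L.entry i x) ∧ L.One b (L.entry i x) ∧
      L.One c (L.entry i x) ∧ L.One e (L.entry i x) := by
  simp only [at4, mul_ne_zero_iff, at1_ne_zero, at3_ne_zero, and_assoc]

lemma add_ne_zero_iff_or {a b : ℕ} : a + b ≠ 0 ↔ a ≠ 0 ∨ b ≠ 0 := by omega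

lemma sat1_ne_zero {a x : ℕ} : L.sat1 a x ≠ 0 ↔
    (L.at1 0 a x ≠ 0 ∨ L.at1 1 a x ≠ 0) ∧ (L.at1 3 a x ≠ 0 ∨ L.at1 4 a x ≠ 0) := by
  simp only [sat1, mul_ne_zero_iff, add_ne_zero_iff_or]

lemma sat2_ne_zero {a b x : ℕ} : L.sat2 a b x ≠ 0 ↔ L.sat1 a x ≠ 0 ∧
    ((L.at2 0 a b x ≠ 0 ∨ L.at2 1 a b x ≠ 0) ∨ L.at2 2 a b x ≠ 0) ∧
    ((L.at2 3 a b x ≠ 0 ∨ L.at2 4 a b x ≠ 0) ∨ L.at2 5 a b x ≠ 0) := by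
  simp only [sat2, mul_ne_zero_iff, add_ne_zero_iff_or]

lemma sat3_ne_zero {a b c x : ℕ} : L.sat3 a b c x ≠ 0 ↔ L.sat2 a b x ≠ 0 ∧
    (((L.at3 0 a b c x ≠ 0 ∧ L.at3 1 a b c x ≠ 0) ∧ L.at3 2 a b c x ≠ 0) ∨
    ((L.at3 3 a b c x ≠ 0 ∧ L.at3 4 a b c x ≠ 0) ∧ L.at3 5 a b c x ≠ 0)) := by
  simp only [sat3, mul_ne_zero_iff, add_ne_zero_iff_or]

lemma sat4_ne_zero {a b c e x : ℕ} : L.sat4 a b c e x ≠ 0 ↔ L.sat3 a b c x ≠ 0 ∧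
    ((L.at4 0 a b c e x ≠ 0 ∧ L.at4 1 a b c e x ≠ 0) ∨
    (L.at4 3 a b c e x ≠ 0 ∧ L.at4 4 a b c e x ≠ 0)) := by
  simp only [sat4, mul_ne_zero_iff, add_ne_zero_iff_or]

/-- The quadruple has ones at the first two places of some half, and the single vector has a one at
one of these two. -/
lemma exists_one_of_sat4_sat1 (hd : 0 < L.d) {a b c e p x : ℕ} (h : L.sat4 a b c e x ≠ 0)
    (h' : L.sat1 p x ≠ 0) :
    ∃ i < L.d, L.One a i ∧ L.One b i ∧ L.One c i ∧ L.One e i ∧ L.One p i := by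
  simp only [sat4_ne_zero, sat1_ne_zero, at4_ne_zero, at1_ne_zero] at h h'
  obtain ⟨⟨-, h⟩, hp, hq⟩ := And.intro h h'
  rcases h with ⟨h0, h1⟩ | ⟨h0, h1⟩
  · rcases hp with hp | hp
    · exact ⟨_, L.entry_lt hd 0 x, h0.1, h0.2.1, h0.2.2.1, h0.2.2.2, hp⟩
    · exact ⟨_, L.entry_lt hd 1 x, h1.1, h1.2.1, h1.2.2.1, h1.2.2.2, hp⟩
  · rcases hq with hp | hp
    · exact ⟨_, L.entry_lt hd 3 x, h0.1, h0.2.1, h0.2.2.1, h0.2.2.2, hp⟩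
    · exact ⟨_, L.entry_lt hd 4 x, h1.1, h1.2.1, h1.2.2.1, h1.2.2.2, hp⟩

/-- The triple has ones throughout some half, and the pair shares a one within that half. -/
lemma exists_one_of_sat3_sat2 (hd : 0 < L.d) {a b c p q x : ℕ} (h : L.sat3 a b c x ≠ 0)
    (h' : L.sat2 p q x ≠ 0) :
    ∃ i < L.d, L.One a i ∧ L.One b i ∧ L.One c i ∧ L.One p i ∧ L.One q i := by
  simp only [sat3_ne_zero, sat2_ne_zero, at3_ne_zero, at2_ne_zero] at h h'
  obtain ⟨⟨-, h⟩, -, hp, hq⟩ := And.intro h h'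
  rcases h with ⟨⟨h0, h1⟩, h2⟩ | ⟨⟨h0, h1⟩, h2⟩
  · rcases hp with (hp | hp) | hp
    · exact ⟨_, L.entry_lt hd 0 x, h0.1, h0.2.1, h0.2.2, hp⟩
    · exact ⟨_, L.entry_lt hd 1 x, h1.1, h1.2.1, h1.2.2, hp⟩
    · exact ⟨_, L.entry_lt hd 2 x, h2.1, h2.2.1, h2.2.2, hp⟩
  · rcases hq with (hp | hp) | hp
    · exact ⟨_, L.entry_lt hd 3 x, h0.1, h0.2.1, h0.2.2, hp⟩
    · exact ⟨_, L.entry_lt hd 4 x, h1.1, h1.2.1, h1.2.2, hp⟩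
    · exact ⟨_, L.entry_lt hd 5 x, h2.1, h2.2.1, h2.2.2, hp⟩

/-- Any five vectors have a common one. -/
def NoOrthogonal : Prop := ∀ a b c e f, a < L.M → b < L.M → c < L.M → e < L.M → f < L.M →
  ∃ i < L.d, L.One a i ∧ L.One b i ∧ L.One c i ∧ L.One e i ∧ L.One f i

/-- Any four vectors have a common one. -/
def Generic : Prop := ∀ a b c e, a < L.M → b < L.M → c < L.M → e < L.M →
  ∃ i < L.d, L.One a i ∧ L.One b i ∧ L.One c i ∧ L.One e i

/-- Six numbers as a function. -/
def six (c₀ c₁ c₂ c₃ c₄ c₅ : ℕ) : ℕ → ℕ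
  | 0 => c₀ | 1 => c₁ | 2 => c₂ | 3 => c₃ | 4 => c₄ | _ => c₅

lemma exists_array (hD : L.D = L.d * L.d * L.d * L.d * L.d * L.d) {c₀ c₁ c₂ c₃ c₄ c₅ : ℕ}
    (h₀ : c₀ < L.d) (h₁ : c₁ < L.d) (h₂ : c₂ < L.d) (h₃ : c₃ < L.d) (h₄ : c₄ < L.d)
    (h₅ : c₅ < L.d) : ∃ x : Fin L.D, L.entry 0 x = c₀ ∧ L.entry 1 x = c₁ ∧ L.entry 2 x = c₂ ∧
      L.entry 3 x = c₃ ∧ L.entry 4 x = c₄ ∧ L.entry 5 x = c₅ := by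
  obtain ⟨x, hx, h⟩ := L.exists_entries hD (six c₀ c₁ c₂ c₃ c₄ c₅) (by
    intro i; unfold six; split <;> assumption)
  exact ⟨⟨x, hx⟩, h 0 (by simp), h 1 (by simp), h 2 (by simp), h 3 (by simp), h 4 (by simp),
    h 5 (by simp)⟩

theorem system_near_five (hD : L.D = L.d * L.d * L.d * L.d * L.d * L.d) (h : L.NoOrthogonal)
    (u v : StackVertex (Fin L.M) (Fin L.D)) : L.system.Near 5 u v := by
  refine StackSystem.near_five ?_ ?_ u v
  · intro a b c d p q r s
    obtain ⟨i, hi, h1⟩ := h a b c d p a.2 b.2 c.2 d.2 p.2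
    obtain ⟨j, hj, h2⟩ := h a b c p q a.2 b.2 c.2 p.2 q.2
    obtain ⟨k, hk, h3⟩ := h a b p q r a.2 b.2 p.2 q.2 r.2
    obtain ⟨l, hl, h4⟩ := h a p q r s a.2 p.2 q.2 r.2 s.2
    -- In the first half `i, i, j`, the vectors `a, b, c` have ones throughout and `d` at the first
    -- two places, while `p` meets it at `i` and `p, q` at `j`. The second half `l, l, k` does the
    -- same with the two stacks exchanged.
    obtain ⟨x, e0, e1, e2, e3, e4, e5⟩ := L.exists_array hD hi hi hj hl hl hk
    refine ⟨x, ?_⟩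
    simp only [system, sat4_ne_zero, sat3_ne_zero, sat2_ne_zero, sat1_ne_zero, at1_ne_zero,
      at2_ne_zero, at3_ne_zero, at4_ne_zero, e0, e1, e2, e3, e4, e5]
    grind
  · intro a b c d p q r
    obtain ⟨i, hi, h1⟩ := h a b c d p a.2 b.2 c.2 d.2 p.2
    obtain ⟨i', hi', h1'⟩ := h a b c d r a.2 b.2 c.2 d.2 r.2
    obtain ⟨j, hj, h2⟩ := h a b c p q a.2 b.2 c.2 p.2 q.2
    obtain ⟨k, hk, h3⟩ := h a b p q r a.2 b.2 p.2 q.2 r.2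
    -- The second place now serves `r`. The other half may be constant, since no stack but `a, b, c,
    -- d` has to fill a half.
    obtain ⟨x, e0, e1, e2, e3, e4, e5⟩ := L.exists_array hD hi hi' hj hk hk hk
    refine ⟨x, ?_⟩
    simp only [system, sat4_ne_zero, sat3_ne_zero, sat2_ne_zero, sat1_ne_zero, at1_ne_zero,
      at2_ne_zero, at3_ne_zero, at4_ne_zero, e0, e1, e2, e3, e4, e5]
    grind

/-- A constant array at a common one of four vectors satisfies their quadruple. This covers the case
of orthogonal vectors too, where the bound five fails. -/
theorem system_connected (hM : 0 < L.M) (hD : L.D = L.d * L.d * L.d * L.d * L.d * L.d)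
    (h : L.Generic) : L.system.graph.Connected := by
  have : Nonempty (Fin L.M) := ⟨⟨0, hM⟩⟩
  refine StackSystem.graph_connected fun a b c d => ?_
  obtain ⟨i, hi, h⟩ := h a b c d a.2 b.2 c.2 d.2
  obtain ⟨x, e0, e1, e2, e3, e4, e5⟩ := L.exists_array hD hi hi hi hi hi hi
  refine ⟨x, ?_⟩
  simp only [system, sat4_ne_zero, sat3_ne_zero, sat2_ne_zero, sat1_ne_zero, at1_ne_zero,
      at2_ne_zero, at3_ne_zero, at4_ne_zero, e0, e1, e2, e3, e4, e5]
  grind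

theorem system_nine_le_length (hd : 0 < L.d) (hg : L.Generic) (h : ¬ L.NoOrthogonal) :
    ∃ u v, ∀ w : L.system.graph.Walk u v, 9 ≤ w.length := by
  unfold NoOrthogonal at h
  push Not at h
  obtain ⟨a, b, c, e, f, ha, hb, hc, he, hf, h⟩ := h
  -- The second quadruple runs backwards, so that the first `k` vectors of one and the first `5 - k`
  -- of the other are always all five.
  refine ⟨.quad ⟨a, ha⟩ ⟨b, hb⟩ ⟨c, hc⟩ ⟨e, he⟩, .quad ⟨f, hf⟩ ⟨e, he⟩ ⟨c, hc⟩ ⟨b, hb⟩,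
    fun w => StackSystem.nine_le_length ?_ ?_ ?_ ?_ ?_ w⟩
  · intro haf
    obtain rfl : a = f := by simpa using haf
    obtain ⟨i, hi, h1, h2, h3, h4⟩ := hg a b c e ha hb hc he
    exact h i hi h1 h2 h3 h4 h1
  · intro x h1 h2
    obtain ⟨i, hi, h1, h2, h3, h4, h5⟩ := L.exists_one_of_sat4_sat1 hd h1 h2
    exact h i hi h1 h2 h3 h4 h5
  · intro x h1 h2
    obtain ⟨i, hi, h1, h2, h3, h4, h5⟩ := L.exists_one_of_sat3_sat2 hd h1 h2
    exact h i hi h1 h2 h3 h5 h4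
  · intro x h1 h2
    obtain ⟨i, hi, h1, h2, h3, h4, h5⟩ := L.exists_one_of_sat3_sat2 hd h2 h1
    exact h i hi h4 h5 h3 h2 h1
  · intro x h1 h2
    obtain ⟨i, hi, h1, h2, h3, h4, h5⟩ := L.exists_one_of_sat4_sat1 hd h2 h1
    exact h i hi h5 h4 h3 h2 h1

end Layout

/-! ### Numbering the vertices and listing the edges -/

/-- A vertex is one of five kinds of tuples. -/
def StackVertex.equivSum (A X : Type) : StackVertex A X ≃
    (((A × A) × A) × A) ⊕ (((A × A) × A) × X) ⊕ (((A × A) × A) × X) ⊕ ((A × A) × X) ⊕ (A × A) where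
  toFun
    | quad a b c e => .inl (((a, b), c), e)
    | triple a b c x => .inr (.inl (((a, b), c), x))
    | split a b r x => .inr (.inr (.inl (((a, b), r), x)))
    | pair a b x => .inr (.inr (.inr (.inl ((a, b), x))))
    | hub a b => .inr (.inr (.inr (.inr (a, b))))
  invFun
    | .inl (((a, b), c), e) => quad a b c e
    | .inr (.inl (((a, b), c), x)) => triple a b c x
    | .inr (.inr (.inl (((a, b), r), x))) => split a b r x
    | .inr (.inr (.inr (.inl ((a, b), x)))) => pair a b x
    | .inr (.inr (.inr (.inr (a, b)))) => hub a b
  left_inv v := by cases v <;> rfl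
  right_inv v := by rcases v with _ | _ | _ | _ | _ <;> rfl

namespace Layout

variable (L : Layout ℕ)

/-- Triples of vectors as numbers. -/
def tripleEquiv (M : ℕ) : (Fin M × Fin M) × Fin M ≃ Fin (M * M * M) :=
  (Equiv.prodCongr finProdFinEquiv (Equiv.refl _)).trans finProdFinEquiv

/-- The numbering of the vertices. -/
def number : StackVertex (Fin L.M) (Fin L.D) ≃ Fin L.size :=
  (StackVertex.equivSum _ _).trans <|
    (Equiv.sumCongr (((tripleEquiv _).prodCongr (Equiv.refl _)).trans finProdFinEquiv) <|
    (Equiv.sumCongr (((tripleEquiv _).prodCongr (Equiv.refl _)).trans finProdFinEquiv) <|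
    (Equiv.sumCongr (((tripleEquiv _).prodCongr (Equiv.refl _)).trans finProdFinEquiv) <|
    (Equiv.sumCongr ((finProdFinEquiv.prodCongr (Equiv.refl _)).trans finProdFinEquiv)
      finProdFinEquiv).trans finSumFinEquiv).trans
      finSumFinEquiv).trans finSumFinEquiv).trans finSumFinEquiv

lemma number_quad (a b c e) : (L.number (.quad a b c e) : ℕ) = L.quad a b c e := by
  have : (L.number (.quad a b c e) : ℕ) = e.val + L.M * (c.val + L.M * (b.val + L.M * a.val)) := rfl
  rw [this, quad]; ring

lemma number_triple (a b c x) : (L.number (.triple a b c x) : ℕ) = L.triple a b c x := by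
  have : (L.number (.triple a b c x) : ℕ) = L.M * L.M * L.M * L.M +
      (x.val + L.D * (c.val + L.M * (b.val + L.M * a.val))) := rfl
  rw [this, triple]; ring

lemma number_split (a b r x) : (L.number (.split a b r x) : ℕ) = L.split a b r x := by
  have : (L.number (.split a b r x) : ℕ) = L.M * L.M * L.M * L.M +
      (L.M * L.M * L.M * L.D + (x.val + L.D * (r.val + L.M * (b.val + L.M * a.val)))) := rfl
  rw [this, split]; ring

lemma number_pair (a b x) : (L.number (.pair a b x) : ℕ) = L.pair a b x := by
  have : (L.number (.pair a b x) : ℕ) = L.M * L.M * L.M * L.M + (L.M * L.M * L.M * L.D +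
      (L.M * L.M * L.M * L.D + (x.val + L.D * (b.val + L.M * a.val)))) := rfl
  rw [this, pair]; ring

lemma number_hub (a b) : (L.number (.hub a b) : ℕ) = L.hub a b := by
  have : (L.number (.hub a b) : ℕ) = L.M * L.M * L.M * L.M + (L.M * L.M * L.M * L.D +
      (L.M * L.M * L.M * L.D + (L.M * L.M * L.D + (b.val + L.M * a.val)))) := rfl
  rw [this, hub]; ring

/-- The parameters of an edge. -/
abbrev Index : Type := ((((Fin L.M × Fin L.M) × Fin L.M) × Fin L.M) × Fin L.D) × Fin L.D

/-- The ends of an edge of kind `j`. -/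
def ends (j : Fin 10) (i : L.Index) :
    StackVertex (Fin L.M) (Fin L.D) × StackVertex (Fin L.M) (Fin L.D) :=
  match j, i with
  | 0, (((((a, b), c), e), x), _) => (.quad a b c e, .triple a b c x)
  | 1, (((((a, b), c), _), x), y) => (.triple a b c x, .triple a b c y)
  | 2, (((((a, b), c), e), x), _) => (.triple a b c x, .split a b e x)
  | 3, (((((a, b), c), e), x), _) => (.split a b c x, .split c e a x)
  | 4, (((((a, b), c), e), x), _) => (.split a b c x, .split a b e x)
  | 5, (((((a, b), c), _), x), y) => (.split a b c x, .split a b c y)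
  | 6, (((((a, b), c), _), x), _) => (.split a b c x, .pair a b x)
  | 7, (((((a, b), _), _), x), y) => (.pair a b x, .pair a b y)
  | 8, (((((a, b), _), _), x), _) => (.pair a b x, .hub a b)
  | 9, (((((a, b), c), e), _), _) => (.hub a b, .hub c e)

/-- The condition and the ends, as numbers. -/
def indexed (j : ℕ) (i : L.Index) : ℕ × ℕ × ℕ :=
  L.kind j i.1.1.1.1.1 i.1.1.1.1.2 i.1.1.1.2 i.1.1.2 i.1.2 i.2

lemma indexed_ends (j : Fin 10) (i : L.Index) :
    (L.indexed j i).2 = ((L.number (L.ends j i).1 : ℕ), (L.number (L.ends j i).2 : ℕ)) := by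
  fin_cases j <;> simp [indexed, kind, ends, number_quad, number_triple, number_split,
    number_pair, number_hub]

/-- Edge `(j, i)` is listed. -/
def Listed (e : Fin 10 × L.Index) : Prop :=
  (L.indexed e.1 e.2).1 ≠ 0 ∧ L.number (L.ends e.1 e.2).1 < L.number (L.ends e.1 e.2).2

/-- The ends show the parameters, the others being zero. Only the kinds 3, 4 and 5 join the same
layers: kind 5 changes the array, 3 and 4 keep it, and a pair of both kinds 3 and 4 would be a loop,
which the strict order excludes. -/
lemma ends_injOn {e e' : Fin 10 × L.Index} (h : L.Listed e) (h' : L.Listed e')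
    (heq : L.ends e.1 e.2 = L.ends e'.1 e'.2) : e = e' := by
  obtain ⟨j, ⟨⟨⟨⟨⟨a, b⟩, c⟩, f⟩, x⟩, y⟩⟩ := e
  obtain ⟨j', ⟨⟨⟨⟨⟨a', b'⟩, c'⟩, f'⟩, x'⟩, y'⟩⟩ := e'
  obtain ⟨h, hne⟩ := h
  obtain ⟨h', -⟩ := h'
  replace hne := L.number.injective.ne_iff.1 hne.ne
  fin_cases j <;> fin_cases j' <;>
    simp [ends, indexed, kind, isZero_ne_zero] at h h' heq hne ⊢ <;> grind

end Layout

/-! ### Every edge is listed exactly once -/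

namespace Layout

variable (L : Layout ℕ)

lemma quad_lt_triple {a b c e a' b' c' x} :
    L.number (.quad a b c e) < L.number (.triple a' b' c' x) := by
  obtain ⟨k, hk⟩ : ∃ k : Fin (L.M * L.M * L.M * L.M), (L.number (.quad a b c e) : ℕ) = k :=
    ⟨_, rfl⟩
  rw [Fin.lt_def, hk, number_triple, triple]
  omega

lemma triple_lt_split {a b c x a' b' r y} :
    L.number (.triple a b c x) < L.number (.split a' b' r y) := by
  obtain ⟨k, hk⟩ : ∃ k : Fin (L.M * L.M * L.M * L.D), (L.number (.triple a b c x) : ℕ) =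
    L.M * L.M * L.M * L.M + k := ⟨_, rfl⟩
  rw [Fin.lt_def, hk, number_split, split]
  omega

lemma split_lt_pair {a b r x a' b' y} :
    L.number (.split a b r x) < L.number (.pair a' b' y) := by
  obtain ⟨k, hk⟩ : ∃ k : Fin (L.M * L.M * L.M * L.D), (L.number (.split a b r x) : ℕ) =
    L.M * L.M * L.M * L.M + (L.M * L.M * L.M * L.D + k) := ⟨_, rfl⟩
  rw [Fin.lt_def, hk, number_pair, pair]
  omega

lemma pair_lt_hub {a b x a' b'} :
    L.number (.pair a b x) < L.number (.hub a' b') := by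
  obtain ⟨k, hk⟩ : ∃ k : Fin (L.M * L.M * L.D), (L.number (.pair a b x) : ℕ) =
    L.M * L.M * L.M * L.M + (L.M * L.M * L.M * L.D + (L.M * L.M * L.M * L.D + k)) := ⟨_, rfl⟩
  rw [Fin.lt_def, hk, number_hub, hub]
  omega

variable {L}

/-- Edges between layers go upwards in the numbering, and the kinds within a layer are symmetric.
Hence nothing is lost by listing only pairs with increasing numbers. -/
lemma lt_or_edge {u v : StackVertex (Fin L.M) (Fin L.D)} (h : L.system.Edge u v) :
    L.number u < L.number v ∨ L.system.Edge v u := by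
  cases h with
  | quad_triple => exact .inl L.quad_lt_triple
  | triple_triple => exact .inr .triple_triple
  | triple_split => exact .inl L.triple_lt_split
  | turn h h' => exact .inr (.turn h' h)
  | swap h h' h'' => exact .inr (.swap h h'' h')
  | split_split => exact .inr .split_split
  | split_pair => exact .inl L.split_lt_pair
  | pair_pair => exact .inr .pair_pair
  | pair_hub => exact .inl L.pair_lt_hub
  | hub_hub => exact .inr .hub_hub

lemma exists_listed (hM : 0 < L.M) (hD : 0 < L.D) {u v : StackVertex (Fin L.M) (Fin L.D)}
    (h : L.system.Edge u v) : ∃ e : Fin 10 × L.Index, (L.indexed e.1 e.2).1 ≠ 0 ∧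
      L.ends e.1 e.2 = (u, v) := by
  let o : Fin L.M := ⟨0, hM⟩
  let z : Fin L.D := ⟨0, hD⟩
  cases h with
  | @quad_triple a b c e x h =>
    exact ⟨(0, (((((a, b), c), e), x), z)), mul_ne_zero h (by simp [isZero, z]), rfl⟩
  | @triple_triple a b c x y =>
    exact ⟨(1, (((((a, b), c), o), x), y)), by simp [indexed, kind, isZero, o], rfl⟩
  | @triple_split a b c r x h h' =>
    exact ⟨(2, (((((a, b), c), r), x), z)),
      mul_ne_zero (mul_ne_zero h h') (by simp [isZero, z]), rfl⟩
  | @turn a b r e x h h' =>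
    exact ⟨(3, (((((a, b), r), e), x), z)),
      mul_ne_zero (mul_ne_zero h h') (by simp [isZero, z]), rfl⟩
  | @swap a b r s x h h' h'' =>
    exact ⟨(4, (((((a, b), r), s), x), z)),
      mul_ne_zero (mul_ne_zero h (mul_ne_zero h' h'')) (by simp [isZero, z]), rfl⟩
  | @split_split a b r x y =>
    exact ⟨(5, (((((a, b), r), o), x), y)), by simp [indexed, kind, isZero, o], rfl⟩
  | @split_pair a b r x =>
    exact ⟨(6, (((((a, b), r), o), x), z)), by simp [indexed, kind, isZero, o, z], rfl⟩
  | @pair_pair a b x y =>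
    exact ⟨(7, (((((a, b), o), o), x), y)), by simp [indexed, kind, isZero, o], rfl⟩
  | @pair_hub a b x =>
    exact ⟨(8, (((((a, b), o), o), x), z)), by simp [indexed, kind, isZero, o, z], rfl⟩
  | @hub_hub a b c e =>
    exact ⟨(9, (((((a, b), c), e), z), z)), by simp [indexed, kind, isZero, z], rfl⟩

lemma edge_of_indexed {e : Fin 10 × L.Index} (h : (L.indexed e.1 e.2).1 ≠ 0) :
    L.system.Edge (L.ends e.1 e.2).1 (L.ends e.1 e.2).2 := by
  obtain ⟨j, ⟨⟨⟨⟨⟨a, b⟩, c⟩, e⟩, x⟩, y⟩⟩ := e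
  fin_cases j
  · exact .quad_triple (mul_ne_zero_iff.1 h).1
  · exact .triple_triple
  · exact .triple_split (mul_ne_zero_iff.1 (mul_ne_zero_iff.1 h).1).1
      (mul_ne_zero_iff.1 (mul_ne_zero_iff.1 h).1).2
  · exact .turn (mul_ne_zero_iff.1 (mul_ne_zero_iff.1 h).1).1
      (mul_ne_zero_iff.1 (mul_ne_zero_iff.1 h).1).2
  · exact .swap (mul_ne_zero_iff.1 (mul_ne_zero_iff.1 h).1).1
      (mul_ne_zero_iff.1 (mul_ne_zero_iff.1 (mul_ne_zero_iff.1 h).1).2).1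
      (mul_ne_zero_iff.1 (mul_ne_zero_iff.1 (mul_ne_zero_iff.1 h).1).2).2
  · exact .split_split
  · exact .split_pair
  · exact .pair_pair
  · exact .pair_hub
  · exact .hub_hub

variable (L)

/-- The graph of a layout. -/
def graph : SimpleGraph (Fin L.size) := L.system.graph.comap L.number.symm

/-- The graph of a layout is the graph of stacks. -/
def graphIso : L.graph ≃g L.system.graph := SimpleGraph.Iso.comap L.number.symm _

/-- The decoding of the parameters of an edge. -/
def index : Fin L.total ≃ L.Index :=
  (((((finProdFinEquiv.prodCongr (Equiv.refl _)).trans finProdFinEquiv).prodCongr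
    (Equiv.refl _)).trans finProdFinEquiv |>.prodCongr (Equiv.refl _)).trans finProdFinEquiv
    |>.prodCongr (Equiv.refl _)).trans finProdFinEquiv |>.symm

/-- The inverse of `finProdFinEquiv` is division with remainder by definition. -/
lemma decoded_eq_indexed (j : ℕ) (k : Fin L.total) : L.decoded j k = L.indexed j (L.index k) := by
  unfold decoded
  simp only [rem_eq_mod]
  rfl

open scoped Classical in
/-- The list of edges. -/
noncomputable def edgeList : List (Fin L.size × Fin L.size) :=
  (List.finRange 10).flatMap fun j => (List.finRange L.total).filterMap fun k =>
    if L.Listed (j, L.index k) then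
      some (L.number (L.ends j (L.index k)).1, L.number (L.ends j (L.index k)).2) else none

/-- The edges of kind `j`, as pairs of numbers. -/
def kindList (j : ℕ) (K : ℕ) : List (ℕ × ℕ) :=
  (List.range K).filterMap fun k => if L.present j k ≠ 0 then some (L.decoded j k).2 else none

lemma present_iff (j : Fin 10) (k : Fin L.total) :
    L.present j k ≠ 0 ↔ L.Listed (j, L.index k) := by
  rw [present, mul_ne_zero_iff, Nat.sub_ne_zero_iff_lt, decoded_eq_indexed, indexed_ends]
  rfl

/-- This identifies the list of pairs of vertices with the numbers the program writes, in the same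
order. -/
lemma edgeList_map : L.edgeList.map (fun e => ((e.1 : ℕ), (e.2 : ℕ))) =
    (List.range 10).flatMap fun j => L.kindList j L.total := by
  rw [edgeList, List.map_flatMap, ← List.map_coe_finRange_eq_range, List.flatMap_map]
  congr 1
  funext j
  rw [kindList, ← List.map_coe_finRange_eq_range, List.map_filterMap, List.filterMap_map]
  congr 1
  funext k
  by_cases h : L.Listed (j, L.index k)
  · simp only [Function.comp, if_pos h, if_pos ((L.present_iff j k).2 h)]
    rw [decoded_eq_indexed, indexed_ends]; rfl
  · simp only [Function.comp, if_neg h, if_neg (mt (L.present_iff j k).1 h)]; rfl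

lemma mem_edgeList {p : Fin L.size × Fin L.size} : p ∈ L.edgeList ↔
    ∃ e, L.Listed e ∧ L.ends e.1 e.2 = (L.number.symm p.1, L.number.symm p.2) := by
  simp only [edgeList, List.mem_flatMap, List.mem_finRange, List.mem_filterMap, true_and]
  constructor
  · rintro ⟨j, k, h⟩
    split at h
    · next hl =>
      refine ⟨_, hl, ?_⟩
      simp only [Option.some.injEq] at h
      simp [← h]
    · simp at h
  · rintro ⟨⟨j, i⟩, hl, h⟩
    exact ⟨j, L.index.symm i, by simp [hl, h]⟩

lemma lt_of_mem_edgeList {p : Fin L.size × Fin L.size} (h : p ∈ L.edgeList) : p.1 < p.2 := by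
  obtain ⟨e, he, h⟩ := L.mem_edgeList.1 h
  have := he.2
  rw [h] at this
  simpa using this

lemma edgeList_nodup : L.edgeList.Nodup := by
  rw [edgeList, List.nodup_flatMap]
  refine ⟨fun j _ => ?_, ?_⟩
  · refine List.Nodup.filterMap ?_ (List.nodup_finRange _)
    intro k k' p hk hk'
    simp only [Option.mem_def, Option.ite_none_right_eq_some, Option.some.injEq] at hk hk'
    have := L.ends_injOn hk.1 hk'.1 (by
      have := hk.2.trans hk'.2.symm
      simp only [Prod.mk.injEq, EmbeddingLike.apply_eq_iff_eq] at this
      exact Prod.ext this.1 this.2)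
    simpa using this
  · refine (List.nodup_finRange 10).imp ?_
    intro j j' hj p hp hp'
    simp only [List.mem_filterMap, List.mem_finRange, true_and, Option.ite_none_right_eq_some,
      Option.some.injEq] at hp hp'
    obtain ⟨k, hk⟩ := hp
    obtain ⟨k', hk'⟩ := hp'
    have := L.ends_injOn hk.1 hk'.1 (by
      have := hk.2.trans hk'.2.symm
      simp only [Prod.mk.injEq, EmbeddingLike.apply_eq_iff_eq] at this
      exact Prod.ext this.1 this.2)
    exact hj (congrArg Prod.fst this)

theorem isEdgeList (hM : 0 < L.M) (hD : 0 < L.D) : IsEdgeList L.graph L.edgeList := by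
  constructor
  · refine List.Nodup.map_on ?_ L.edgeList_nodup
    intro p hp q hq h
    have hp := L.lt_of_mem_edgeList hp
    have hq := L.lt_of_mem_edgeList hq
    rcases Sym2.eq_iff.1 h with h | h
    · exact Prod.ext h.1 h.2
    · exact absurd hp (by rw [h.1, h.2]; exact hq.asymm)
  · intro u v
    have key : ∀ u v, (u, v) ∈ L.edgeList → L.graph.Adj u v := by
      intro u v h
      have hlt := L.lt_of_mem_edgeList h
      obtain ⟨e, he, h⟩ := L.mem_edgeList.1 h
      have := edge_of_indexed he.1
      rw [h] at this
      exact StackSystem.adj_iff.2 ⟨by simpa using hlt.ne, .inl this⟩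
    have key' : ∀ u v, u ≠ v → L.system.Edge (L.number.symm u) (L.number.symm v) →
        (u, v) ∈ L.edgeList ∨ (v, u) ∈ L.edgeList := by
      have lt : ∀ u v, u < v → L.system.Edge (L.number.symm u) (L.number.symm v) →
          (u, v) ∈ L.edgeList := by
        intro u v huv h
        obtain ⟨e, he, h⟩ := exists_listed hM hD h
        exact L.mem_edgeList.2 ⟨e, ⟨he, by simpa [h] using huv⟩, h⟩
      intro u v huv h
      rcases lt_or_edge h with h' | h'
      · exact .inl (lt u v (by simpa using h') h)
      · rcases lt_or_gt_of_ne huv with hlt | hlt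
        · exact .inl (lt u v hlt h)
        · exact .inr (lt v u hlt h')
    simp only [List.mem_map, Sym2.eq_iff]
    constructor
    · rintro ⟨p, hp, ⟨rfl, rfl⟩ | ⟨rfl, rfl⟩⟩
      · exact key _ _ hp
      · exact (key _ _ hp).symm
    · intro h
      obtain ⟨hne, h⟩ := StackSystem.adj_iff.1 (show L.system.graph.Adj _ _ from h)
      have hne : u ≠ v := by rintro rfl; exact hne rfl
      have : (u, v) ∈ L.edgeList ∨ (v, u) ∈ L.edgeList := by
        rcases h with h | h
        · exact key' u v hne h
        · exact (key' v u hne.symm h).symm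
      rcases this with h | h
      · exact ⟨_, h, .inl ⟨rfl, rfl⟩⟩
      · exact ⟨_, h, .inr ⟨rfl, rfl⟩⟩

lemma length_edgeList_le : L.edgeList.length ≤ 10 * L.total := by
  rw [edgeList, List.length_flatMap]
  refine (List.sum_le_card_nsmul _ L.total ?_).trans (by simp)
  intro x hx
  obtain ⟨j, -, rfl⟩ := List.mem_map.1 hx
  exact (List.length_filterMap_le _ _).trans (by simp)

theorem graph_diam (hM : 0 < L.M) (hd : 0 < L.d)
    (hD : L.D = L.d * L.d * L.d * L.d * L.d * L.d) (hg : L.Generic) :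
    L.graph.Connected ∧ (L.NoOrthogonal → L.graph.diam ≤ 5) ∧
      (¬ L.NoOrthogonal → 9 ≤ L.graph.diam) := by
  have hc : L.graph.Connected := L.graphIso.connected_iff.2 (L.system_connected hM hD hg)
  refine ⟨hc, fun h => L.graphIso.diam_le (L.system_near_five hD h), fun h => ?_⟩
  obtain ⟨u, v, h⟩ := L.system_nine_le_length hd hg h
  exact L.graphIso.le_diam hc h

end Layout

/-! ### Programs of the machine: relocation and running times -/

namespace RAM

/-- The expression with all registers and arrays moved by `r` places. -/
def Expr.shift (r : ℕ) : Expr → Expr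
  | .const c => .const c
  | .reg i => .reg (r + i)
  | .get k e => .get (r + k) (e.shift r)
  | .op o a b => .op o (a.shift r) (b.shift r)

/-- The program with all registers and arrays moved by `r` places. -/
def Prog.shift (r : ℕ) : Prog → Prog
  | .skip => .skip
  | .assign i e => .assign (r + i) (e.shift r)
  | .store k a e => .store (r + k) (a.shift r) (e.shift r)
  | .seq p q => .seq (p.shift r) (q.shift r)
  | .branch c p q => .branch (c.shift r) (p.shift r) (q.shift r)
  | .loop c p => .loop (c.shift r) (p.shift r)

/-- `s'` contains `s`, moved by `r` places. -/
def State.Shifted (r : ℕ) (s s' : State) : Prop :=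
  (∀ i, s'.reg (r + i) = s.reg i) ∧ ∀ k, s'.arr (r + k) = s.arr k

variable {r : ℕ} {s s' : State}

lemma Expr.eval_shift (h : s.Shifted r s') (e : Expr) : (e.shift r).eval s' = e.eval s := by
  induction e with
  | const c => rfl
  | reg i => exact h.1 i
  | get k e ih => simp [shift, eval, ih, h.2]
  | op o a b iha ihb => simp [shift, eval, iha, ihb]

lemma Expr.cost_shift (h : s.Shifted r s') (e : Expr) : (e.shift r).cost s' = e.cost s := by
  induction e with
  | const c => rfl
  | reg i => simp [shift, cost, h.1]
  | get k e ih => simp [shift, cost, ih, eval_shift h, h.2]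
  | op o a b iha ihb => simp [shift, cost, iha, ihb, eval_shift h]

lemma State.Shifted.setReg (h : s.Shifted r s') (i v : ℕ) :
    (s.setReg i v).Shifted r (s'.setReg (r + i) v) := by
  refine ⟨fun j => ?_, h.2⟩
  simp only [State.setReg, Function.update_apply, h.1, Nat.add_left_cancel_iff]

lemma State.Shifted.setArr (h : s.Shifted r s') (k j v : ℕ) :
    (s.setArr k j v).Shifted r (s'.setArr (r + k) j v) := by
  refine ⟨h.1, fun l => ?_⟩
  simp only [State.setArr, Function.update_apply, h.2, Nat.add_left_cancel_iff]

/-- Costs depend on values, never on the indices of registers or arrays, so the moved program takes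
exactly the same time. -/
lemma Exec.shift {p : Prog} {t : ℕ} {u : State} (he : Exec p s t u) (h : s.Shifted r s') :
    ∃ u', Exec (p.shift r) s' t u' ∧ u.Shifted r u' := by
  induction he generalizing s' with
  | skip s => exact ⟨s', .skip s', h⟩
  | assign i e s =>
    refine ⟨_, ?_, h.setReg i _⟩
    have := Exec.assign (r + i) (e.shift r) s'
    rwa [Expr.cost_shift h, Expr.eval_shift h] at this
  | store k a e s =>
    refine ⟨_, ?_, h.setArr k _ _⟩
    have := Exec.store (r + k) (a.shift r) (e.shift r) s'
    rwa [Expr.cost_shift h, Expr.cost_shift h, Expr.eval_shift h, Expr.eval_shift h] at this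
  | seq _ _ ih₁ ih₂ =>
    obtain ⟨u', h₁, hs⟩ := ih₁ h
    obtain ⟨u'', h₂, hs⟩ := ih₂ hs
    exact ⟨u'', .seq h₁ h₂, hs⟩
  | @branch_pos c p q s u t hc _ ih =>
    obtain ⟨u', h₁, hs⟩ := ih h
    refine ⟨u', ?_, hs⟩
    rw [← Expr.cost_shift h]
    exact .branch_pos (by rwa [Expr.eval_shift h]) h₁
  | @branch_zero c p q s u t hc _ ih =>
    obtain ⟨u', h₁, hs⟩ := ih h
    refine ⟨u', ?_, hs⟩
    rw [← Expr.cost_shift h]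
    exact .branch_zero (by rwa [Expr.eval_shift h]) h₁
  | @loop_pos c p s u v t t' hc _ _ ih₁ ih₂ =>
    obtain ⟨u', h₁, hs⟩ := ih₁ h
    obtain ⟨u'', h₂, hs⟩ := ih₂ hs
    refine ⟨u'', ?_, hs⟩
    rw [← Expr.cost_shift h]
    exact .loop_pos (by rwa [Expr.eval_shift h]) h₁ h₂
  | @loop_zero c p s hc =>
    refine ⟨s', ?_, h⟩
    rw [← Expr.cost_shift h]
    exact .loop_zero (by rwa [Expr.eval_shift h])

/-! ### Time bounds when all numbers in memory are bounded -/

/-- The size of an expression, constants being counted with their values. -/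
def Expr.weight : Expr → ℕ
  | .const c => c + 1
  | .reg _ => 1
  | .get _ e => e.weight + 1
  | .op _ a b => a.weight + b.weight + 1

/-- All numbers in the memory are at most `2 ^ W`. -/
def State.Bounded (W : ℕ) (s : State) : Prop :=
  (∀ i, s.reg i ≤ 2 ^ W) ∧ ∀ k j, s.arr k j ≤ 2 ^ W

lemma Expr.weight_pos (e : Expr) : 0 < e.weight := by cases e <;> simp [weight]

/-- Positive exponents make both powers at least two, and then their sum is at most their product.
-/
lemma Op.eval_le (o : Op) {a b i j : ℕ} (ha : a ≤ 2 ^ i) (hb : b ≤ 2 ^ j) (hi : 0 < i)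
    (hj : 0 < j) : o.eval a b ≤ 2 ^ (i + j) := by
  have h2i : 2 ≤ 2 ^ i := Nat.le_self_pow hi.ne' 2
  have h2j : 2 ≤ 2 ^ j := Nat.le_self_pow hj.ne' 2
  have hi1 : 2 ^ i ≤ 2 ^ (i + j) := Nat.pow_le_pow_right (by simp) (by simp)
  cases o
  · rw [pow_add]; simp only [Op.eval]; nlinarith
  · exact (Nat.sub_le _ _).trans (ha.trans hi1)
  · rw [pow_add]; exact Nat.mul_le_mul ha hb
  · exact (Nat.div_le_self _ _).trans (ha.trans hi1)

variable {W : ℕ}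

lemma Expr.eval_le (hs : s.Bounded W) (hW : 0 < W) (e : Expr) : e.eval s ≤ 2 ^ (W * e.weight) := by
  induction e with
  | const c =>
    refine (Nat.lt_two_pow_self (n := c)).le.trans (Nat.pow_le_pow_right (by simp) ?_)
    simp only [weight]; nlinarith
  | reg i => simpa [weight] using hs.1 i
  | get k e ih =>
    exact (hs.2 _ _).trans (Nat.pow_le_pow_right (by simp) (by simp only [weight]; nlinarith))
  | op o a b iha ihb =>
    refine (o.eval_le iha ihb ?_ ?_).trans (Nat.pow_le_pow_right (by simp) ?_)
    · exact Nat.mul_pos hW a.weight_pos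
    · exact Nat.mul_pos hW b.weight_pos
    · simp only [weight]; nlinarith

lemma size_le_of_le_two_pow {a i : ℕ} (h : a ≤ 2 ^ i) : a.size ≤ i + 1 :=
  Nat.size_le.2 (h.trans_lt (Nat.pow_lt_pow_right (by simp) (by simp)))

/-- The factor by which the cost of an expression may exceed the bit length of the memory. -/
def Expr.rate (e : Expr) : ℕ := 3 * e.weight * e.weight

lemma Expr.cost_le (hs : s.Bounded W) (hW : 0 < W) (e : Expr) : e.cost s ≤ e.rate * W := by
  have key : e.cost s ≤ e.weight * (W * e.weight + 2) := by
    induction e with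
    | const c =>
      have := size_le_of_le_two_pow (Expr.eval_le hs hW (.const c))
      simp only [eval, cost, weight] at this ⊢
      nlinarith
    | reg i =>
      have := size_le_of_le_two_pow (Expr.eval_le hs hW (.reg i))
      simp only [eval, cost, weight] at this ⊢
      nlinarith
    | get k e ih =>
      have := size_le_of_le_two_pow (Expr.eval_le hs hW (.get k e))
      simp only [eval, cost, weight] at this ⊢
      nlinarith
    | op o a b iha ihb =>
      have := size_le_of_le_two_pow (Expr.eval_le hs hW (.op o a b))
      simp only [eval, cost, weight] at this ⊢
      nlinarith [Nat.zero_le (a.weight * b.weight * W)]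
  have := e.weight_pos
  have : 2 ≤ 2 * (W * e.weight) := by nlinarith [Nat.mul_pos hW this]
  unfold rate
  nlinarith

/-- The sum of the rates of the expressions of a program. -/
def Prog.rate : Prog → ℕ
  | .skip => 1
  | .assign _ e => e.rate + 1
  | .store _ a e => a.rate + e.rate + 1
  | .seq p q => p.rate + q.rate
  | .branch c p q => c.rate + 1 + p.rate + q.rate
  | .loop c p => c.rate + 1 + p.rate

/-- The program halts in a state with the property `Q`, no instruction being executed more than
`B` times, and all numbers having at most `W` bits, as far as the running time is concerned. -/
def Within (W B : ℕ) (p : Prog) (s : State) (Q : State → Prop) : Prop :=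
  ∃ t s', Exec p s t s' ∧ t ≤ p.rate * B * W ∧ Q s'

variable {B B' : ℕ} {p q : Prog} {Q Q' : State → Prop}

lemma Within.mono (h : Within W B p s Q) (hB : B ≤ B') (hQ : ∀ s', Q s' → Q' s') :
    Within W B' p s Q' := by
  obtain ⟨t, s', he, ht, hq⟩ := h
  exact ⟨t, s', he, ht.trans (by gcongr), hQ _ hq⟩

/-- The bound is linear in the rate, and rates add up, so the same `W` and `B` serve both parts. -/
lemma Within.seq (h : Within W B p s Q) (h' : ∀ s', Q s' → Within W B q s' Q') :
    Within W B (p.seq q) s Q' := by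
  obtain ⟨t, s', he, ht, hq⟩ := h
  obtain ⟨t', s'', he', ht', hq'⟩ := h' s' hq
  refine ⟨_, s'', .seq he he', ?_, hq'⟩
  rw [Prog.rate, add_mul, add_mul]
  omega

lemma Within.skip (hW : 0 < W) (hB : 0 < B) (hQ : Q s) : Within W B .skip s Q :=
  ⟨_, _, .skip s, by rw [Prog.rate, one_mul]; exact Nat.mul_pos hB hW, hQ⟩

lemma cost_add_le {c W B C D : ℕ} (hW : 0 < W) (hB : 0 < B) (h : c ≤ C * W) (hD : C + 1 ≤ D) :
    c + 1 ≤ D * B * W :=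
  calc c + 1 ≤ C * W + W := by omega
    _ = (C + 1) * 1 * W := by ring
    _ ≤ D * B * W := by gcongr; omega

lemma Within.assign (hs : s.Bounded W) (hW : 0 < W) (hB : 0 < B) {i : ℕ} {e : Expr}
    (hQ : Q (s.setReg i (e.eval s))) : Within W B (.assign i e) s Q :=
  ⟨_, _, .assign i e s, cost_add_le hW hB (e.cost_le hs hW) le_rfl, hQ⟩

lemma Within.store (hs : s.Bounded W) (hW : 0 < W) (hB : 0 < B) {k : ℕ} {a e : Expr}
    (hQ : Q (s.setArr k (a.eval s) (e.eval s))) : Within W B (.store k a e) s Q :=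
  ⟨_, _, .store k a e s, cost_add_le (C := a.rate + e.rate) hW hB
    (by rw [add_mul]; exact add_le_add (a.cost_le hs hW) (e.cost_le hs hW)) le_rfl, hQ⟩

lemma Within.branch (hs : s.Bounded W) (hW : 0 < W) (hB : 0 < B) {c : Expr}
    (h₁ : c.eval s ≠ 0 → Within W B p s Q) (h₂ : c.eval s = 0 → Within W B q s Q) :
    Within W B (.branch c p q) s Q := by
  have hc := cost_add_le hW hB (c.cost_le hs hW) le_rfl
  have hr : (Prog.branch c p q).rate * B * W =
    (c.rate + 1) * B * W + p.rate * B * W + q.rate * B * W := by rw [Prog.rate]; ring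
  by_cases h : c.eval s = 0
  · obtain ⟨t, s', he, ht, hq⟩ := h₂ h
    exact ⟨_, s', .branch_zero h he, by omega, hq⟩
  · obtain ⟨t, s', he, ht, hq⟩ := h₁ h
    exact ⟨_, s', .branch_pos h he, by omega, hq⟩

/-- Repeat `p` with register `i` running from zero to the value of `e`. -/
def Prog.for (i : ℕ) (e : Expr) (p : Prog) : Prog :=
  -- Truncated subtraction ends the loop when the counter reaches the value of `e`, which is
  -- evaluated anew in every round.
  .seq (.assign i (.const 0)) (.loop (e - .reg i) (.seq p (.assign i (.reg i + 1))))

/-- The test is evaluated once more than the body, hence `n + 1`. The invariant is asked for after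
the counter has been advanced. -/
lemma Within.for {i n N : ℕ} {e : Expr} (hW : 0 < W) (hB : 0 < B) (hN : n + 1 ≤ N)
    (Inv : ℕ → State → Prop) (hb : ∀ k s, Inv k s → s.Bounded W) (hs : s.Bounded W)
    (h₀ : Inv 0 (s.setReg i 0)) (hi : ∀ k s, Inv k s → s.reg i = k)
    (he : ∀ k s, Inv k s → e.eval s = n)
    (hp : ∀ k s, k < n → Inv k s →
      Within W B p s fun s' => s'.Bounded W ∧ s'.reg i = k ∧ Inv (k + 1) (s'.setReg i (k + 1))) :
    Within W (N * B) (Prog.for i e p) s (Inv n) := by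
  have hN0 : 0 < N := by omega
  set c₁ := ((e - .reg i).rate + 1) * B * W with hc₁
  set c₂ := ((Expr.reg i + 1).rate + 1) * B * W with hc₂
  have hc : ∀ k s, Inv k s → (e - .reg i).cost s + 1 ≤ c₁ := fun k s h =>
    cost_add_le hW hB ((e - .reg i).cost_le (hb _ _ h) hW) le_rfl
  have main : ∀ m k s, k + m = n → Inv k s → ∃ t s',
      Exec (.loop (e - .reg i) (.seq p (.assign i (.reg i + 1)))) s t s' ∧
      t ≤ m * (c₁ + p.rate * B * W + c₂) + c₁ ∧ Inv n s' := by
    intro m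
    induction m with
    | zero =>
      intro k s hk h
      obtain rfl : k = n := by omega
      refine ⟨_, s, .loop_zero ?_, ?_, h⟩
      · simp [he _ _ h, hi _ _ h]
      · simpa using hc _ _ h
    | succ m ih =>
      intro k s hk h
      obtain ⟨t, s₁, he₁, ht, hb₁, hi₁, h₁⟩ := hp k s (by omega) h
      obtain ⟨t', s₂, he₂, ht', h₂⟩ := ih (k + 1) _ (by omega) h₁
      have ha : Exec (.assign i (.reg i + 1)) s₁ ((Expr.reg i + 1).cost s₁ + 1) (s₁.setReg i (k + 1)) := by
        simpa [hi₁] using Exec.assign i (.reg i + 1) s₁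
      refine ⟨_, s₂, .loop_pos ?_ (.seq he₁ ha) he₂, ?_, h₂⟩
      · simp only [Expr.eval_sub, he _ _ h, Expr.eval_reg, hi _ _ h]; omega
      · have h1 := hc _ _ h
        have h2 : (Expr.reg i + 1).cost s₁ + 1 ≤ c₂ :=
          cost_add_le hW hB ((Expr.reg i + 1).cost_le hb₁ hW) le_rfl
        rw [add_mul, one_mul]
        omega
  obtain ⟨t, s', hx, ht, h⟩ := main n 0 (s.setReg i 0) (by simp) h₀
  refine ⟨_, s', .seq (.assign i (.const 0) s) hx, ?_, h⟩
  have h0 : (Expr.const 0).cost s + 1 ≤ ((Expr.const 0).rate + 1) * (N * B) * W :=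
    cost_add_le hW (Nat.mul_pos hN0 hB) ((Expr.const 0).cost_le hs hW) le_rfl
  have h1 : n * (c₁ + p.rate * B * W + c₂) + c₁ ≤ N * (c₁ + p.rate * B * W + c₂) :=
    calc _ ≤ n * (c₁ + p.rate * B * W + c₂) + (c₁ + p.rate * B * W + c₂) := by
          rw [add_assoc c₁]; omega
      _ = (n + 1) * (c₁ + p.rate * B * W + c₂) := by ring
      _ ≤ _ := by gcongr
  have h2 : (Prog.for i e p).rate * (N * B) * W = ((Expr.const 0).rate + 1) * (N * B) * W +
      N * (c₁ + p.rate * B * W + c₂) := by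
    rw [hc₁, hc₂]; simp only [Prog.for, Prog.rate]; ring
  omega

end RAM

/-! ### The program of the reduction -/

namespace RAM

@[simp] lemma State.reg_setReg (s : State) (i v j : ℕ) :
    (s.setReg i v).reg j = if j = i then v else s.reg j := by
  simp [State.setReg, Function.update_apply]

@[simp] lemma State.arr_setReg (s : State) (i v : ℕ) : (s.setReg i v).arr = s.arr := rfl

@[simp] lemma State.reg_setArr (s : State) (k j v : ℕ) : (s.setArr k j v).reg = s.reg := rfl

@[simp] lemma State.arr_setArr (s : State) (k j v l : ℕ) :
    (s.setArr k j v).arr l = if l = k then Function.update (s.arr k) j v else s.arr l := by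
  simp [State.setArr, Function.update_apply]

lemma State.Bounded.setReg {W : ℕ} {s : State} (h : s.Bounded W) (i : ℕ) {v : ℕ}
    (hv : v ≤ 2 ^ W) : (s.setReg i v).Bounded W := by
  refine ⟨fun j => ?_, h.2⟩
  rw [State.reg_setReg]; split
  · exact hv
  · exact h.1 j

lemma State.Bounded.setArr {W : ℕ} {s : State} (h : s.Bounded W) (k j : ℕ) {v : ℕ}
    (hv : v ≤ 2 ^ W) : (s.setArr k j v).Bounded W := by
  refine ⟨h.1, fun l i => ?_⟩
  rw [State.arr_setArr]; split
  · rw [Function.update_apply]; split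
    · exact hv
    · exact h.2 k i
  · exact h.2 l i

end RAM

namespace Reduction

open RAM Layout

/-- Nonzero if `x` and `y` have the same value. -/
def same (x y : Expr) : Expr := isZero ((x - y) + (y - x))

lemma eval_same_ne_zero {s : State} {x y : Expr} :
    (same x y).eval s ≠ 0 ↔ x.eval s = y.eval s := by
  rw [same, eval_isZero, isZero_ne_zero, Expr.eval_add, Expr.eval_sub, Expr.eval_sub]
  omega

/-- The block length goes to register `1`, its power of two to register `2`, the layout to
registers `3`, `4` and `5`, the number of clauses to register `6`, and the powers of two to
array `1`. -/
def setupProg (b₀ : ℕ) : Prog :=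
  -- The maximum of `b₀` and of a fifth of the number of variables, rounded up.
  .seq (.assign 1 (.const b₀ + ((.get 0 (.const 0) + .const 4) / .const 5 - .const b₀))) <|
  .seq (.store 1 (.const 0) 1) <|
  .seq (.for 10 (.reg 1) (.store 1 (.reg 10 + 1) (.get 1 (.reg 10) + .get 1 (.reg 10)))) <|
  .seq (.assign 2 (.get 1 (.reg 1))) <|
  .seq (.assign 3 (.const 5 * .reg 2)) <|
  .seq (.assign 6 (.get 0 (.const 1))) <|
  .seq (.assign 4 (.reg 6 + .const 5)) <|
  .assign 5 (.reg 4 * .reg 4 * .reg 4 * .reg 4 * .reg 4 * .reg 4)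

/-- The vector in register `13` makes the literal in register `9` true. -/
def testExpr : Expr :=
  same (.reg 13 / .reg 2) (.reg 9 / .const 2 / .reg 1) *
    same (rem (.reg 13 / .get 1 (rem (.reg 9 / .const 2) (.reg 1))) (.const 2))
      (rem (.reg 9) (.const 2))

/-- The literal at the place in register `7` is entered into the table. -/
def literalProg : Prog :=
  .seq (.assign 9 (.get 0 (.reg 7))) <|
  .seq (.assign 7 (.reg 7 + 1)) <|
  -- The table marks zero entries, and the memory starts with zeros, so the ones of the vectors need
  -- no writing.
  .for 13 (.reg 3) (.branch testExpr (.store 2 (.reg 13 * .reg 4 + .reg 11) 1) .skip)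

/-- The clause at the place in register `7` is entered into the table. -/
def clauseProg : Prog :=
  .seq (.assign 8 (.get 0 (.reg 7))) <|
  .seq (.assign 7 (.reg 7 + 1)) <|
  .for 12 (.reg 8) literalProg

/-- Array `2` gets the table of the zero entries of the vectors. -/
def tableProg : Prog :=
  .seq (.assign 7 (.const 2)) <|
  .seq (.for 11 (.reg 6) clauseProg) <|
  .for 13 (.reg 3) (.store 2 (.reg 13 * .reg 4 + (.reg 6 + .reg 13 / .reg 2)) 1)

/-- The layout in the memory. -/
def lay : Layout Expr := ⟨.reg 3, .reg 4, .reg 5, .get 2⟩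

/-- Append a value to the output in array `20`, whose length stands in register `20`. -/
def push (e : Expr) : Prog := .seq (.store 20 (.reg 20) e) (.assign 20 (.reg 20 + 1))

/-- Write the edges of kind `j`. -/
def kindProg (j : ℕ) : Prog :=
  .for 14 lay.total (.branch (lay.present j (.reg 14))
    (.seq (push (lay.decoded j (.reg 14)).2.1) (push (lay.decoded j (.reg 14)).2.2)) .skip)

/-- Write the edges of several kinds. -/
def kindsProg : List ℕ → Prog
  | [] => .skip
  | j :: l => .seq (kindProg j) (kindsProg l)

/-- Write the graph. -/
def graphProg : Prog :=
  .seq (push lay.size) <|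
  .seq (push (.const 0)) <|
  .seq (kindsProg (List.range 10)) <|
  .store 20 1 ((.reg 20 - .const 2) / .const 2)

/-- Translate the formula into a graph. -/
def buildProg (b₀ : ℕ) : Prog := .seq (setupProg b₀) (.seq tableProg graphProg)

/-! ### Invariants -/

/-- The table is the characteristic function of `F`. -/
def Tab (F : Set ℕ) (s : State) : Prop := ∀ x, (x ∈ F → s.arr 2 x = 1) ∧ (x ∉ F → s.arr 2 x = 0)

/-- The output is `l`. -/
structure Out (l : List ℕ) (s : State) : Prop where
  length : s.reg 20 = l.length
  cells : ∀ j, s.arr 20 j = l.getD j 0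
  reg : ∀ i, 20 < i → s.reg i = 0
  arr : ∀ k j, 20 < k → s.arr k j = 0

lemma Tab.setReg {F : Set ℕ} {s : State} (h : Tab F s) (i v : ℕ) : Tab F (s.setReg i v) := h

lemma Tab.setArr {F : Set ℕ} {s : State} (h : Tab F s) {k : ℕ} (hk : k ≠ 2) (j v : ℕ) :
    Tab F (s.setArr k j v) := by
  intro x; simpa [hk.symm] using h x

lemma Tab.insert {F : Set ℕ} {s : State} (h : Tab F s) (y : ℕ) :
    Tab (insert y F) (s.setArr 2 y 1) := by
  intro x
  have := h x
  by_cases hx : x = y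
  · simp [hx]
  · simpa [hx] using this

lemma Out.setReg {l : List ℕ} {s : State} (h : Out l s) {i : ℕ} (hi : i < 20) (v : ℕ) :
    Out l (s.setReg i v) := by
  obtain ⟨h1, h2, h3, h4⟩ := h
  refine ⟨by simp [h1, hi.ne'], h2, fun j hj => ?_, h4⟩
  simp [h3 j hj, (hi.trans hj).ne']

lemma Out.setArr {l : List ℕ} {s : State} (h : Out l s) {k : ℕ} (hk : k < 20) (j v : ℕ) :
    Out l (s.setArr k j v) := by
  obtain ⟨h1, h2, h3, h4⟩ := h
  refine ⟨h1, fun j => by simp [h2, hk.ne'], h3, fun i j hj => ?_⟩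
  simp [h4 i j hj, (hk.trans hj).ne']

lemma Out.push {l : List ℕ} {s : State} (h : Out l s) (v : ℕ) :
    Out (l ++ [v]) ((s.setArr 20 l.length v).setReg 20 (l.length + 1)) := by
  obtain ⟨h1, h2, h3, h4⟩ := h
  refine ⟨by simp, fun j => ?_, fun j hj => ?_, fun i j hj => ?_⟩
  · simp only [State.arr_setReg, State.arr_setArr, if_true, Function.update_apply, h2]
    simp only [List.getD_eq_getElem?_getD, List.getElem?_append]
    grind
  · simp [h3 j hj, hj.ne']
  · simp [h4 i j hj, hj.ne']

lemma Out.set {l : List ℕ} {s : State} (h : Out l s) {i : ℕ} (hi : i < l.length) (v : ℕ) :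
    Out (l.set i v) (s.setArr 20 i v) := by
  obtain ⟨h1, h2, h3, h4⟩ := h
  refine ⟨by simp [h1], fun j => ?_, h3, fun i j hj => ?_⟩
  · simp only [State.arr_setArr, if_true, Function.update_apply, h2]
    simp only [List.getD_eq_getElem?_getD, List.getElem?_set]
    grind
  · simp [h4 i j hj, hj.ne']

/-- `Out` asks for zeros beyond place 20 for this purpose: seen from place 20, the memory is an
initial state. -/
lemma Out.shifted {l : List ℕ} {s : State} (h : Out l s) : (start l).Shifted 20 s := by
  refine ⟨fun i => ?_, fun k => funext fun j => ?_⟩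
  · by_cases hi : i = 0
    · simp [hi, h.length, start]
    · simp [hi, start, h.reg (20 + i) (by omega)]
  · by_cases hk : k = 0
    · simp [hk, h.cells, start]
    · simp [hk, start, h.arr (20 + k) j (by omega)]

/-- The memory after the setup. -/
structure Setup (W b m : ℕ) (a₀ : ℕ → ℕ) (s : State) : Prop where
  bounded : s.Bounded W
  r1 : s.reg 1 = b
  r2 : s.reg 2 = 2 ^ b
  r3 : s.reg 3 = 5 * 2 ^ b
  r4 : s.reg 4 = m + 5
  r5 : s.reg 5 = (m + 5) * (m + 5) * (m + 5) * (m + 5) * (m + 5) * (m + 5)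
  r6 : s.reg 6 = m
  a0 : s.arr 0 = a₀
  a1 : ∀ j ≤ b, s.arr 1 j = 2 ^ j

section

variable {W b m : ℕ} {a₀ : ℕ → ℕ} {s : State}

lemma Setup.setReg (h : Setup W b m a₀ s) {i v : ℕ} (hi : 6 < i) (hv : v ≤ 2 ^ W) :
    Setup W b m a₀ (s.setReg i v) := by
  obtain ⟨h0, h1, h2, h3, h4, h5, h6, h7, h8⟩ := h
  refine ⟨h0.setReg i hv, ?_, ?_, ?_, ?_, ?_, ?_, h7, h8⟩ <;>
    rw [State.reg_setReg, if_neg (by omega)] <;> assumption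

lemma Setup.setArr (h : Setup W b m a₀ s) {k v : ℕ} (j : ℕ) (hk : 1 < k) (hv : v ≤ 2 ^ W) :
    Setup W b m a₀ (s.setArr k j v) := by
  obtain ⟨h0, h1, h2, h3, h4, h5, h6, h7, h8⟩ := h
  refine ⟨h0.setArr k j hv, h1, h2, h3, h4, h5, h6, ?_, ?_⟩
  · rwa [State.arr_setArr, if_neg (by omega)]
  · rwa [State.arr_setArr, if_neg (by omega)]

/-- The layout of numbers for the table `F`. -/
noncomputable def layout (b m : ℕ) (F : Set ℕ) : Layout ℕ where
  M := 5 * 2 ^ b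
  d := m + 5
  D := (m + 5) * (m + 5) * (m + 5) * (m + 5) * (m + 5) * (m + 5)
  look := F.indicator 1

lemma Setup.evaluates (h : Setup W b m a₀ s) {F : Set ℕ} (hF : Tab F s) :
    Evaluates s lay (layout b m F) := by
  refine ⟨h.r3, h.r4, h.r5, fun e => ?_⟩
  by_cases he : e.eval s ∈ F
  · simp [lay, layout, he, (hF _).1 he]
  · simp [lay, layout, he, (hF _).2 he]

/-- All numbers occurring in the reduction are at most `2 ^ W`. -/
structure Fits (W b m : ℕ) (l : List ℕ) : Prop where
  cells : ∀ j, l.getD j 0 ≤ 2 ^ W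
  length : l.length ≤ 2 ^ W
  -- There are at most `10 * total` edges of two numbers each. Neither quantity depends on the
  -- table, so the empty one stands for all.
  graph : (layout b m ∅).size + 20 * (layout b m ∅).total + 2 ≤ 2 ^ W

/-- Vector `a` makes the literal with the code `l` true. -/
def LiteralTrue (b a l : ℕ) : Prop :=
  a / 2 ^ b = l / 2 / b ∧ a / 2 ^ (l / 2 % b) % 2 = l % 2

lemma Setup.eval_testExpr (h : Setup W b m a₀ s) (hb : 0 < b) :
    testExpr.eval s ≠ 0 ↔ LiteralTrue b (s.reg 13) (s.reg 9) := by
  -- The table of powers of two reaches only up to `b`.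
  have hlt : s.reg 9 / 2 % b ≤ b := (Nat.mod_lt _ hb).le
  simp only [testExpr, Expr.eval_mul, mul_ne_zero_iff, eval_same_ne_zero, LiteralTrue,
    Expr.eval_div, eval_rem, rem_eq_mod, Expr.eval_reg, Expr.eval_get, Expr.eval_const, h.r1, h.r2,
    h.a1 _ hlt]

end

end Reduction

namespace RAM

variable {W B : ℕ} {s : State} {p : Prog} {Q : State → Prop}

lemma Within.assign_seq (hs : s.Bounded W) (hW : 0 < W) (hB : 0 < B) {i : ℕ} {e : Expr}
    (h : Within W B p (s.setReg i (e.eval s)) Q) : Within W B (.seq (.assign i e) p) s Q :=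
  (Within.assign (Q := (· = s.setReg i (e.eval s))) hs hW hB rfl).seq fun _ h' => h' ▸ h

lemma Within.store_seq (hs : s.Bounded W) (hW : 0 < W) (hB : 0 < B) {k : ℕ} {a e : Expr}
    (h : Within W B p (s.setArr k (a.eval s) (e.eval s)) Q) :
    Within W B (.seq (.store k a e) p) s Q :=
  (Within.store (Q := (· = s.setArr k (a.eval s) (e.eval s))) hs hW hB rfl).seq fun _ h' => h' ▸ h

end RAM

/-! ### Room for all numbers, and the setup -/

namespace Reduction

open RAM Layout

variable {W b m : ℕ} {l : List ℕ}

lemma le_total_of_pos {M D : ℕ} (hM : 0 < M) (hD : 0 < D) :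
    M ≤ M * M * M * M * D * D ∧ D ≤ M * M * M * M * D * D := by
  have h1 : 0 < M * M * M * M := by positivity
  constructor
  · calc M = 1 * 1 * 1 * M * 1 * 1 := by ring
      _ ≤ M * M * M * M * D * D := by gcongr <;> omega
  · calc D = 1 * 1 * D := by ring
      _ ≤ M * M * M * M * D * D := by gcongr <;> omega

lemma le_pow_six (d : ℕ) (hd : 0 < d) : d ≤ d * d * d * d * d * d :=
  calc d = 1 * 1 * 1 * 1 * 1 * d := by ring
    _ ≤ _ := by gcongr <;> omega

lemma layout_M_pos : 0 < 5 * 2 ^ b := by positivity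

lemma layout_D_pos : 0 < (m + 5) * (m + 5) * (m + 5) * (m + 5) * (m + 5) * (m + 5) := by positivity

lemma M_le_total : 5 * 2 ^ b ≤ (layout b m ∅).total := (le_total_of_pos layout_M_pos layout_D_pos).1

lemma D_le_total : (m + 5) * (m + 5) * (m + 5) * (m + 5) * (m + 5) * (m + 5) ≤
    (layout b m ∅).total := (le_total_of_pos layout_M_pos layout_D_pos).2

namespace Fits

variable (h : Fits W b m l)

include h

lemma total : (layout b m ∅).total ≤ 2 ^ W := by have := h.graph; omega
lemma M : 5 * 2 ^ b ≤ 2 ^ W := M_le_total.trans h.total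
lemma D : (m + 5) * (m + 5) * (m + 5) * (m + 5) * (m + 5) * (m + 5) ≤ 2 ^ W :=
  D_le_total.trans h.total
lemma d : m + 5 ≤ 2 ^ W := (le_pow_six _ (by simp)).trans h.D
lemma block : b ≤ 2 ^ W := by
  have := h.M; have := Nat.lt_two_pow_self (n := b); omega

end Fits

theorem setup_within {b₀ n : ℕ} (hfit : Fits W b m l) (hW : 0 < W) (hn : l.getD 0 0 = n)
    (hm : l.getD 1 0 = m) (hb : b₀ + ((n + 4) / 5 - b₀) = b) :
    Within W (b + 1) (setupProg b₀) (start l)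
      fun s => Setup W b m (fun j => l.getD j 0) s ∧ Out [] s ∧ Tab ∅ s := by
  have hB : 0 < b + 1 := by simp
  have hstart : (start l).Bounded W := by
    refine ⟨fun i => ?_, fun k j => ?_⟩
    · simp only [start]; split
      · exact hfit.length
      · exact Nat.zero_le _
    · simp only [start]; split
      · exact hfit.cells j
      · exact Nat.zero_le _
  have e1 : (Expr.const b₀ + ((Expr.get 0 (.const 0) + .const 4) / .const 5 - .const b₀)).eval
      (start l) = b := by simpa [start, ← hn] using hb
  have one : 1 ≤ 2 ^ W := Nat.one_le_two_pow
  unfold setupProg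
  refine Within.assign_seq hstart hW hB ?_
  rw [e1]
  have hs1 := hstart.setReg 1 hfit.block
  refine Within.store_seq hs1 hW hB ?_
  have hs2 : (((start l).setReg 1 b).setArr 1 0 1).Bounded W := hs1.setArr 1 0 one
  refine Within.seq (Q := fun s => s.Bounded W ∧ s.reg 1 = b ∧
    s.arr 0 = (fun j => l.getD j 0) ∧ (∀ j ≤ b, s.arr 1 j = 2 ^ j) ∧ Out [] s ∧ Tab ∅ s) ?_ ?_
  · rw [show b + 1 = (b + 1) * 1 by simp]
    refine (Within.for (n := b) hW one_pos le_rfl (fun k s => s.Bounded W ∧ s.reg 1 = b ∧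
      s.arr 0 = (fun j => l.getD j 0) ∧ (∀ j ≤ k, s.arr 1 j = 2 ^ j) ∧ Out [] s ∧ Tab ∅ s ∧
      s.reg 10 = k) (fun k s h => h.1) hs2 ?_ ?_ ?_ ?_).mono le_rfl ?_
    · refine ⟨hs2.setReg 10 (Nat.zero_le _), by simp, by simp [start], by simp, ?_, ?_, by simp⟩
      · refine Out.setReg (Out.setArr (Out.setReg ?_ (by simp) _) (by simp) _ _) (by simp) _
        exact ⟨by simp [start], by simp [start], fun i hi => by simp [start]; omega,
          fun i j hi => by simp [start]; omega⟩
      · exact fun x => ⟨fun h => h.elim, fun _ => by simp [start]⟩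
    · exact fun k s h => h.2.2.2.2.2.2
    · exact fun k s h => h.2.1
    · rintro k s hk ⟨h1, h2, h3, h4, h5, h6, h7⟩
      have hle : 2 ^ (k + 1) ≤ 2 ^ W := by
        have h1 : 2 ^ (k + 1) ≤ 2 ^ b := Nat.pow_le_pow_right (by simp) hk
        have := hfit.M
        omega
      have hv : (Expr.get 1 (.reg 10) + Expr.get 1 (.reg 10)).eval s = 2 ^ (k + 1) := by
        simp [h7, h4 k le_rfl]; ring
      refine Within.store h1 hW one_pos ?_
      rw [hv]
      have hb' := h1.setArr 1 ((Expr.reg 10 + 1).eval s) hle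
      refine ⟨hb', by simpa using h7, hb'.setReg 10 ?_, by simp [h2], by simp [h3], ?_,
        (h5.setArr (by simp) _ _).setReg (by simp) _, (h6.setArr (by simp) _ _).setReg _ _, by simp⟩
      · exact Nat.lt_two_pow_self.le.trans hle
      · intro j hj
        simp only [State.arr_setReg, State.arr_setArr, if_true, Expr.eval_add, Expr.eval_reg, h7,
          Expr.eval_one, Function.update_apply]
        split
        · next h => rw [h]
        · exact h4 j (by omega)
    · exact fun s ⟨h1, h2, h3, h4, h5, h6, h7⟩ => ⟨h1, h2, h3, h4, h5, h6⟩
  · rintro s ⟨h1, h2, h3, h4, h5, h6⟩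
    have hM := hfit.M
    have hd := hfit.d
    have hD := hfit.D
    refine Within.assign_seq h1 hW hB ?_
    rw [show (Expr.get 1 (Expr.reg 1)).eval s = 2 ^ b by simp [h2, h4 b le_rfl]]
    replace h1 := h1.setReg 2 (v := 2 ^ b) (by omega)
    refine Within.assign_seq h1 hW hB ?_
    simp only [Expr.eval_mul, Expr.eval_const, Expr.eval_reg, State.reg_setReg, if_true]
    replace h1 := h1.setReg 3 hM
    refine Within.assign_seq h1 hW hB ?_
    simp only [Expr.eval_get, Expr.eval_const, State.arr_setReg, h3, hm]
    replace h1 := h1.setReg 6 (v := m) (by omega)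
    refine Within.assign_seq h1 hW hB ?_
    simp only [Expr.eval_add, Expr.eval_const, Expr.eval_reg, State.reg_setReg, if_true]
    replace h1 := h1.setReg 4 hd
    refine Within.assign h1 hW hB ?_
    simp only [Expr.eval_mul, Expr.eval_reg, State.reg_setReg, if_true]
    replace h1 := h1.setReg 5 hD
    refine ⟨⟨h1, by simp [h2], by simp, by simp, by simp, by simp, by simp, by simpa using h3,
      by simpa using h4⟩, ?_, h6⟩
    exact ((((h5.setReg (by simp) _).setReg (by simp) _).setReg (by simp) _).setReg (by simp)
      _).setReg (by simp) _

end Reduction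

/-! ### Reading the formula and filling the table -/

namespace Reduction

open RAM Layout

/-- A formula as an input, the literals being coded by numbers. -/
def encodeCodes (n : ℕ) (cl : List (List ℕ)) : List ℕ :=
  n :: cl.length :: cl.flatMap fun c => c.length :: c

/-- The place where clause `k` begins. -/
def offset (cl : List (List ℕ)) (k : ℕ) : ℕ :=
  2 + ((cl.take k).flatMap fun c => c.length :: c).length

lemma offset_succ {cl : List (List ℕ)} {k : ℕ} (hk : k < cl.length) :
    offset cl (k + 1) = offset cl k + 1 + cl[k].length := by
  simp only [offset, List.take_succ_eq_append_getElem hk, List.flatMap_append, List.length_append,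
    List.flatMap_cons, List.flatMap_nil, List.append_nil, List.length_cons]
  omega

lemma getD_offset {n : ℕ} {cl : List (List ℕ)} {k : ℕ} (hk : k < cl.length) {i : ℕ}
    (hi : i ≤ cl[k].length) :
    (encodeCodes n cl).getD (offset cl k + i) 0 = (cl[k].length :: cl[k]).getD i 0 := by
  have h : encodeCodes n cl = (n :: cl.length :: (cl.take k).flatMap fun c => c.length :: c) ++
      ((cl[k].length :: cl[k]) ++ (cl.drop (k + 1)).flatMap fun c => c.length :: c) := by
    have : cl.flatMap (fun c => c.length :: c) = (cl.take k).flatMap (fun c => c.length :: c) ++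
        ((cl[k].length :: cl[k]) ++ (cl.drop (k + 1)).flatMap fun c => c.length :: c) := by
      rw [← List.flatMap_cons (f := fun c : List ℕ => c.length :: c),
        ← List.drop_eq_getElem_cons hk, ← List.flatMap_append, List.take_append_drop]
    rw [encodeCodes, this]
    simp
  have ho : offset cl k =
      (n :: cl.length :: (cl.take k).flatMap fun c => c.length :: c).length := by
    simp [offset]; omega
  simp only [List.getD_eq_getElem?_getD]
  rw [h, ho, List.getElem?_append_right (by omega), Nat.add_sub_cancel_left,
    List.getElem?_append_left (by simp; omega)]

lemma offset_le (n : ℕ) (cl : List (List ℕ)) (k : ℕ) :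
    offset cl k ≤ (encodeCodes n cl).length := by
  have : encodeCodes n cl = (n :: cl.length :: (cl.take k).flatMap fun c => c.length :: c) ++
      ((cl.drop k).flatMap fun c => c.length :: c) := by
    have : cl.flatMap (fun c => c.length :: c) = (cl.take k).flatMap (fun c => c.length :: c) ++
        (cl.drop k).flatMap fun c => c.length :: c := by
      rw [← List.flatMap_append, List.take_append_drop]
    rw [encodeCodes, this]
    simp
  rw [this, List.length_append, List.length_cons, List.length_cons, offset]
  omega

/-- The zero entries of the vectors at the first `k` clauses. -/
def clauseSet (b d : ℕ) (cl : List (List ℕ)) (k : ℕ) : Set ℕ :=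
  {x | ∃ a < 5 * 2 ^ b, ∃ c < k, x = a * d + c ∧ ∃ l ∈ cl.getD c [], LiteralTrue b a l}

/-- The zero entries of the first `k` vectors at the coordinates for the blocks. -/
def blockSet (b m d : ℕ) (k : ℕ) : Set ℕ := {x | ∃ a < k, x = a * d + (m + a / 2 ^ b)}

/-- The zero entries of the vectors. -/
def zeroSet (b : ℕ) (cl : List (List ℕ)) : Set ℕ :=
  clauseSet b (cl.length + 5) cl cl.length ∪ blockSet b cl.length (cl.length + 5) (5 * 2 ^ b)

variable {W b m : ℕ} {a₀ : ℕ → ℕ}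

/-- The state during the construction of the table. -/
structure Tabling (W b m : ℕ) (a₀ : ℕ → ℕ) (F : Set ℕ) (s : State) : Prop where
  setup : Setup W b m a₀ s
  out : Out [] s
  tab : Tab F s

lemma Tabling.setReg {F : Set ℕ} {s : State} (h : Tabling W b m a₀ F s) {i v : ℕ}
    (hi : 6 < i) (hi' : i < 20) (hv : v ≤ 2 ^ W) : Tabling W b m a₀ F (s.setReg i v) :=
  ⟨h.setup.setReg hi hv, h.out.setReg hi' v, h.tab.setReg i v⟩

lemma Tabling.insert {F : Set ℕ} {s : State} (h : Tabling W b m a₀ F s) (y : ℕ) :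
    Tabling W b m a₀ (insert y F) (s.setArr 2 y 1) :=
  ⟨h.setup.setArr y (by simp) Nat.one_le_two_pow, h.out.setArr (by simp) _ _, h.tab.insert y⟩

lemma Tabling.congr {F F' : Set ℕ} {s : State} (h : Tabling W b m a₀ F s) (hF : F = F') :
    Tabling W b m a₀ F' s := hF ▸ h

/-- The registers 7, 8, 11 and 12 belong to the loops around this one and are therefore tracked
through it. -/
theorem literal_within (hW : 0 < W) (hb : 0 < b) (hM : 5 * 2 ^ b ≤ 2 ^ W) {F : Set ℕ} {s : State}
    {c pos q len : ℕ} (h : Tabling W b m a₀ F s) (hc : s.reg 11 = c) (hpos : s.reg 7 = pos)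
    (hq : s.reg 12 = q) (hlen : s.reg 8 = len) (hpos' : pos + 1 ≤ 2 ^ W) :
    Within W (5 * 2 ^ b + 1) literalProg s fun s' =>
      Tabling W b m a₀
        (F ∪ {x | ∃ a < 5 * 2 ^ b, x = a * (m + 5) + c ∧ LiteralTrue b a (a₀ pos)}) s' ∧
      s'.reg 11 = c ∧ s'.reg 7 = pos + 1 ∧ s'.reg 12 = q ∧ s'.reg 8 = len := by
  have hB : 0 < 5 * 2 ^ b + 1 := by simp
  unfold literalProg
  refine Within.assign_seq h.setup.bounded hW hB ?_
  rw [show (Expr.get 0 (.reg 7)).eval s = a₀ pos by simp [h.setup.a0, hpos]]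
  have hle : a₀ pos ≤ 2 ^ W := by rw [← h.setup.a0]; exact h.setup.bounded.2 0 pos
  replace h := h.setReg (i := 9) (by simp) (by simp) hle
  refine Within.assign_seq h.setup.bounded hW hB ?_
  rw [show (Expr.reg 7 + 1).eval (s.setReg 9 (a₀ pos)) = pos + 1 by simp [hpos]]
  replace h := h.setReg (i := 7) (by simp) (by simp) hpos'
  rw [← mul_one (5 * 2 ^ b + 1)]
  refine (Within.for (n := 5 * 2 ^ b) hW one_pos le_rfl (fun k s' =>
    Tabling W b m a₀ (F ∪ {x | ∃ a < k, x = a * (m + 5) + c ∧ LiteralTrue b a (a₀ pos)}) s' ∧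
    s'.reg 11 = c ∧ s'.reg 7 = pos + 1 ∧ s'.reg 12 = q ∧ s'.reg 8 = len ∧ s'.reg 9 = a₀ pos ∧
    s'.reg 13 = k) (fun k s' h => h.1.setup.bounded) h.setup.bounded ?_ ?_ ?_ ?_).mono le_rfl ?_
  · exact ⟨(h.setReg (by simp) (by simp) (Nat.zero_le _)).congr (by simp), by simp [hc], by simp,
      by simp [hq], by simp [hlen], by simp, by simp⟩
  · exact fun k s' h => h.2.2.2.2.2.2
  · exact fun k s' h => h.1.setup.r3
  · rintro k s' hk ⟨h, h11, h7, h12, h8, h9, h13⟩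
    refine Within.branch h.setup.bounded hW one_pos (fun ht => ?_) (fun ht => ?_)
    · rw [h.setup.eval_testExpr hb, h13, h9] at ht
      refine Within.store h.setup.bounded hW one_pos ?_
      rw [show (Expr.reg 13 * Expr.reg 4 + Expr.reg 11).eval s' = k * (m + 5) + c by
        simp [h13, h11, h.setup.r4]]
      have h' := h.insert (k * (m + 5) + c)
      refine ⟨h'.setup.bounded, h13, (h'.setReg (by simp) (by simp) (by omega)).congr ?_,
        by simp [h11], by simp [h7], by simp [h12], by simp [h8], by simp [h9], by simp⟩
      ext x
      simp only [Set.mem_insert_iff, Set.mem_union, Set.mem_ofPred_eq]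
      constructor
      · rintro (rfl | hx | ⟨a, ha, hx⟩)
        · exact .inr ⟨k, by simp, rfl, ht⟩
        · exact .inl hx
        · exact .inr ⟨a, by omega, hx⟩
      · rintro (hx | ⟨a, ha, hx⟩)
        · exact .inr (.inl hx)
        · rcases Nat.lt_succ_iff_lt_or_eq.1 ha with ha | rfl
          · exact .inr (.inr ⟨a, ha, hx⟩)
          · exact .inl hx.1
    · have ht : ¬ LiteralTrue b k (a₀ pos) := by
        rw [← h9, ← h13, ← h.setup.eval_testExpr hb, not_not]; exact ht
      refine Within.skip hW one_pos ?_
      refine ⟨h.setup.bounded, h13, (h.setReg (by simp) (by simp) (by omega)).congr ?_,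
        by simp [h11], by simp [h7], by simp [h12], by simp [h8], by simp [h9], by simp⟩
      ext x
      simp only [Set.mem_union, Set.mem_ofPred_eq]
      constructor
      · rintro (hx | ⟨a, ha, hx⟩)
        · exact .inl hx
        · exact .inr ⟨a, by omega, hx⟩
      · rintro (hx | ⟨a, ha, hx⟩)
        · exact .inl hx
        · rcases Nat.lt_succ_iff_lt_or_eq.1 ha with ha | rfl
          · exact .inr ⟨a, ha, hx⟩
          · exact absurd hx.2 ht
  · exact fun s' ⟨h, h11, h7, h12, h8, h9, h13⟩ => ⟨h, h11, h7, h12, h8⟩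

theorem clause_within (hW : 0 < W) (hb : 0 < b) (hM : 5 * 2 ^ b ≤ 2 ^ W) {n : ℕ}
    {cl : List (List ℕ)} (hlen : (encodeCodes n cl).length ≤ 2 ^ W)
    (ha : ∀ j, a₀ j = (encodeCodes n cl).getD j 0) {N k : ℕ} (hk : k < cl.length)
    (hN : cl[k].length + 1 ≤ N) {s : State} (h : Tabling W b m a₀ (clauseSet b (m + 5) cl k) s)
    (hc : s.reg 11 = k) (hpos : s.reg 7 = offset cl k) :
    Within W (N * (5 * 2 ^ b + 1)) clauseProg s fun s' =>
      Tabling W b m a₀ (clauseSet b (m + 5) cl (k + 1)) s' ∧ s'.reg 11 = k ∧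
      s'.reg 7 = offset cl (k + 1) := by
  have hB : 0 < 5 * 2 ^ b + 1 := by simp
  have hB' : 0 < N * (5 * 2 ^ b + 1) := Nat.mul_pos (by omega) hB
  have hoff : offset cl k + 1 + cl[k].length ≤ 2 ^ W := by
    rw [← offset_succ hk]; exact (offset_le n cl (k + 1)).trans hlen
  unfold clauseProg
  refine Within.assign_seq h.setup.bounded hW hB' ?_
  rw [show (Expr.get 0 (.reg 7)).eval s = cl[k].length by
    have := getD_offset (n := n) hk (i := 0) (by simp)
    simp only [Expr.eval_get, h.setup.a0, Expr.eval_reg, hpos, ha]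
    simpa using this]
  replace h := h.setReg (i := 8) (v := cl[k].length) (by simp) (by simp) (by omega)
  refine Within.assign_seq h.setup.bounded hW hB' ?_
  rw [show (Expr.reg 7 + 1).eval (s.setReg 8 cl[k].length) = offset cl k + 1 by simp [hpos]]
  replace h := h.setReg (i := 7) (v := offset cl k + 1) (by simp) (by simp) (by omega)
  refine (Within.for (n := cl[k].length) hW hB hN (fun q s' =>
    Tabling W b m a₀ (clauseSet b (m + 5) cl k ∪ {x | ∃ a < 5 * 2 ^ b, x = a * (m + 5) + k ∧
      ∃ l ∈ cl[k].take q, LiteralTrue b a l}) s' ∧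
    s'.reg 11 = k ∧ s'.reg 7 = offset cl k + 1 + q ∧ s'.reg 12 = q ∧ s'.reg 8 = cl[k].length)
    (fun k s' h => h.1.setup.bounded) h.setup.bounded ?_ ?_ ?_ ?_).mono le_rfl ?_
  · exact ⟨(h.setReg (by simp) (by simp) (Nat.zero_le _)).congr (by simp), by simp [hc], by simp,
      by simp, by simp⟩
  · exact fun q s' h => h.2.2.2.1
  · exact fun q s' h => h.2.2.2.2
  · rintro q s' hq ⟨h, h11, h7, h12, h8⟩
    refine (literal_within hW hb hM h h11 h7 h12 h8 (by omega)).mono le_rfl ?_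
    rintro s'' ⟨h, h11, h7, h12, h8⟩
    refine ⟨h.setup.bounded, h12, (h.setReg (by simp) (by simp) (by omega)).congr ?_, by simp [h11],
      by simp [h7]; omega, by simp, by simp [h8]⟩
    have hcell : a₀ (offset cl k + 1 + q) = cl[k][q] := by
      have := getD_offset (n := n) hk (i := q + 1) (by omega)
      rw [ha, show offset cl k + 1 + q = offset cl k + (q + 1) by omega, this]
      simp [hq]
    rw [hcell, Set.union_assoc]
    congr 1
    ext x
    simp only [Set.mem_union, Set.mem_ofPred_eq, List.take_succ_eq_append_getElem hq,
      List.mem_append, List.mem_singleton]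
    constructor
    · rintro (⟨a, ha, hx, l, hl, ht⟩ | ⟨a, ha, hx, ht⟩)
      · exact ⟨a, ha, hx, l, .inl hl, ht⟩
      · exact ⟨a, ha, hx, _, .inr rfl, ht⟩
    · rintro ⟨a, ha, hx, l, hl | rfl, ht⟩
      · exact .inl ⟨a, ha, hx, l, hl, ht⟩
      · exact .inr ⟨a, ha, hx, ht⟩
  · rintro s' ⟨h, h11, h7, h12, h8⟩
    refine ⟨h.congr ?_, h11, by rw [h7, offset_succ hk]⟩
    ext x
    simp only [clauseSet, Set.mem_union, Set.mem_ofPred_eq, List.take_length]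
    constructor
    · rintro (⟨a, ha, c, hc, hx⟩ | ⟨a, ha, hx, ht⟩)
      · exact ⟨a, ha, c, by omega, hx⟩
      · exact ⟨a, ha, k, by simp, hx, by simpa [hk] using ht⟩
    · rintro ⟨a, ha, c, hc, hx, ht⟩
      rcases Nat.lt_succ_iff_lt_or_eq.1 hc with hc | rfl
      · exact .inl ⟨a, ha, c, hc, hx, ht⟩
      · exact .inr ⟨a, ha, hx, by simpa [hk] using ht⟩

/-- Three nested loops, over clauses, literals and vectors, give the three factors, each with one
more for its last test. -/
theorem table_within (hW : 0 < W) (hb : 0 < b) (hM : 5 * 2 ^ b ≤ 2 ^ W) {n : ℕ}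
    {cl : List (List ℕ)} (hlen : (encodeCodes n cl).length ≤ 2 ^ W)
    (ha : ∀ j, a₀ j = (encodeCodes n cl).getD j 0) {N : ℕ} (hN : ∀ c ∈ cl, c.length + 1 ≤ N)
    (hN0 : 0 < N) {s : State} (h : Tabling W b cl.length a₀ ∅ s) :
    Within W ((cl.length + 1) * (N * (5 * 2 ^ b + 1))) tableProg s
      (Tabling W b cl.length a₀ (zeroSet b cl)) := by
  have hB : 0 < 5 * 2 ^ b + 1 := by simp
  have hB' : 0 < N * (5 * 2 ^ b + 1) := Nat.mul_pos (by omega) hB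
  have hB'' : 0 < (cl.length + 1) * (N * (5 * 2 ^ b + 1)) := Nat.mul_pos (by omega) hB'
  have h2 : 2 + cl.length ≤ 2 ^ W := by
    have := offset_le n cl cl.length
    have h3 : cl.length ≤ (cl.flatMap fun c => c.length :: c).length := by
      rw [List.length_flatMap]
      refine (List.card_nsmul_le_sum _ 1 ?_).trans' (by simp)
      intro x hx
      obtain ⟨c, -, rfl⟩ := List.mem_map.1 hx
      simp
    simp only [offset, List.take_length] at this
    omega
  unfold tableProg
  refine Within.assign_seq h.setup.bounded hW hB'' ?_
  rw [Expr.eval_const]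
  replace h := h.setReg (i := 7) (v := 2) (by simp) (by simp) (by omega)
  refine Within.seq (Q := Tabling W b cl.length a₀ (clauseSet b (cl.length + 5) cl cl.length))
    ?_ ?_
  · refine (Within.for (n := cl.length) hW hB' le_rfl (fun k s' =>
      Tabling W b cl.length a₀ (clauseSet b (cl.length + 5) cl k) s' ∧ s'.reg 11 = k ∧
      s'.reg 7 = offset cl k)
      (fun k s' h => h.1.setup.bounded) h.setup.bounded ?_ ?_ ?_ ?_).mono le_rfl ?_
    · exact ⟨(h.setReg (by simp) (by simp) (Nat.zero_le _)).congr (by simp [clauseSet]), by simp,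
        by simp [offset]⟩
    · exact fun q s' h => h.2.1
    · exact fun q s' h => h.1.setup.r6
    · rintro k s' hk ⟨h, h11, h7⟩
      refine (clause_within hW hb hM hlen ha hk (hN _ (List.getElem_mem hk)) h h11 h7).mono
        le_rfl ?_
      rintro s'' ⟨h, h11, h7⟩
      exact ⟨h.setup.bounded, h11, h.setReg (by simp) (by simp) (by omega), by simp, by simp [h7]⟩
    · exact fun s' h => h.1
  · intro s h
    refine Within.mono (B := (5 * 2 ^ b + 1) * 1)
      (Within.for (n := 5 * 2 ^ b) hW one_pos le_rfl (fun k s' =>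
      Tabling W b cl.length a₀ (clauseSet b (cl.length + 5) cl cl.length ∪
        blockSet b cl.length (cl.length + 5) k) s' ∧ s'.reg 13 = k)
      (fun k s' h => h.1.setup.bounded) h.setup.bounded ?_ ?_ ?_ ?_) ?_ ?_
    · exact ⟨(h.setReg (by simp) (by simp) (Nat.zero_le _)).congr (by simp [blockSet]), by simp⟩
    · exact fun q s' h => h.2
    · exact fun q s' h => h.1.setup.r3
    · rintro k s' hk ⟨h, h13⟩
      refine Within.store h.setup.bounded hW one_pos ?_
      rw [show (Expr.reg 13 * .reg 4 + (.reg 6 + .reg 13 / .reg 2)).eval s' =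
        k * (cl.length + 5) + (cl.length + k / 2 ^ b) by
          simp [h13, h.setup.r4, h.setup.r6, h.setup.r2]]
      have h' := h.insert (k * (cl.length + 5) + (cl.length + k / 2 ^ b))
      refine ⟨h'.setup.bounded, h13, (h'.setReg (by simp) (by simp) (by omega)).congr ?_, by simp⟩
      ext x
      simp only [Set.mem_insert_iff, Set.mem_union, blockSet, Set.mem_ofPred_eq]
      constructor
      · rintro (rfl | hx | ⟨a, ha, hx⟩)
        · exact .inr ⟨k, by simp, rfl⟩
        · exact .inl hx
        · exact .inr ⟨a, by omega, hx⟩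
      · rintro (hx | ⟨a, ha, hx⟩)
        · exact .inr (.inl hx)
        · rcases Nat.lt_succ_iff_lt_or_eq.1 ha with ha | rfl
          · exact .inr (.inr ⟨a, ha, hx⟩)
          · exact .inl hx
    · rw [mul_one]
      calc 5 * 2 ^ b + 1 = 1 * (1 * (5 * 2 ^ b + 1)) := by ring
        _ ≤ _ := by gcongr <;> omega
    · exact fun s' h => h.1

end Reduction

/-! ### Writing the edge list -/

namespace Reduction

open RAM Layout

variable {W B b m : ℕ} {a₀ : ℕ → ℕ} {F : Set ℕ} {s : State} {l : List ℕ}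

/-- The state during the output of the graph. -/
structure Writing (W b m : ℕ) (a₀ : ℕ → ℕ) (F : Set ℕ) (l : List ℕ) (s : State) : Prop where
  setup : Setup W b m a₀ s
  tab : Tab F s
  out : Out l s

lemma Writing.setReg (h : Writing W b m a₀ F l s) {i v : ℕ} (hi : 6 < i) (hi' : i < 20)
    (hv : v ≤ 2 ^ W) : Writing W b m a₀ F l (s.setReg i v) :=
  ⟨h.setup.setReg hi hv, h.tab.setReg i v, h.out.setReg hi' v⟩

lemma Writing.congr {l' : List ℕ} (h : Writing W b m a₀ F l s) (hl : l = l') :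
    Writing W b m a₀ F l' s := hl ▸ h

lemma push_within (hW : 0 < W) (hB : 0 < B) (h : Writing W b m a₀ F l s) {e : Expr} {v : ℕ}
    (he : e.eval s = v) (hv : v ≤ 2 ^ W) (hl : l.length + 1 ≤ 2 ^ W) :
    Within W B (push e) s fun s' => Writing W b m a₀ F (l ++ [v]) s' ∧ s'.reg 14 = s.reg 14 := by
  unfold push
  refine Within.store_seq h.setup.bounded hW hB ?_
  rw [he, Expr.eval_reg, h.out.length]
  have h' := h.setup.setArr (k := 20) l.length (by simp) hv
  refine Within.assign h'.bounded hW hB ?_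
  rw [show (Expr.reg 20 + 1).eval (s.setArr 20 l.length v) = l.length + 1 by simp [h.out.length]]
  exact ⟨⟨h'.setReg (by simp) hl, (h.tab.setArr (by simp) _ _).setReg _ _, h.out.push v⟩, by simp⟩

/-- The two numbers of a pair. -/
def two (e : ℕ × ℕ) : List ℕ := [e.1, e.2]

lemma length_flatMap_two (E : List (ℕ × ℕ)) : (E.flatMap two).length = 2 * E.length := by
  induction E with
  | nil => rfl
  | cons e E ih => simp [List.flatMap_cons, two] at ih ⊢; omega

lemma length_kindList_le (L : Layout ℕ) (j K : ℕ) : (L.kindList j K).length ≤ K :=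
  (List.length_filterMap_le _ _).trans (by simp)

lemma kindList_succ (L : Layout ℕ) (j K : ℕ) : L.kindList j (K + 1) =
    L.kindList j K ++ if L.present j K ≠ 0 then [(L.decoded j K).2] else [] := by
  simp only [kindList, List.range_succ, List.filterMap_append, List.append_cancel_left_eq]
  split <;> simp [*]

lemma decoded_lt (L : Layout ℕ) {j k : ℕ} (hj : j < 10) (hk : k < L.total) :
    (L.decoded j k).2.1 < L.size ∧ (L.decoded j k).2.2 < L.size := by
  have h := L.decoded_eq_indexed j ⟨k, hk⟩
  have h' := L.indexed_ends ⟨j, hj⟩ (L.index ⟨k, hk⟩)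
  simp only at h h'
  rw [h, h']
  exact ⟨Fin.isLt _, Fin.isLt _⟩

/-- Each round appends at most two numbers; `hl` keeps the length of the output within the bound on
the memory. -/
theorem kind_within (hW : 0 < W) (hfit : (layout b m ∅).size + 20 * (layout b m ∅).total + 2 ≤ 2 ^ W)
    (h : Writing W b m a₀ F l s) {j : ℕ} (hj : j < 10)
    (hl : l.length + 2 * (layout b m F).total ≤ 2 ^ W) :
    Within W ((layout b m F).total + 1) (kindProg j) s
      (Writing W b m a₀ F (l ++ ((layout b m F).kindList j (layout b m F).total).flatMap two)) := by
  set L := layout b m F with hL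
  replace hfit : L.size + 20 * L.total + 2 ≤ 2 ^ W := hfit
  rw [← mul_one (L.total + 1)]
  refine (Within.for (n := L.total) hW one_pos le_rfl (fun k s' =>
    Writing W b m a₀ F (l ++ (L.kindList j k).flatMap two) s' ∧ s'.reg 14 = k)
    (fun k s' h => h.1.setup.bounded) h.setup.bounded ?_ ?_ ?_ ?_).mono le_rfl fun s' h => h.1
  · exact ⟨(h.setReg (by simp) (by simp) (Nat.zero_le _)).congr (by simp [kindList]), by simp⟩
  · exact fun k s' h => h.2
  · exact fun k s' h => (h.1.setup.evaluates h.1.tab).total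
  · rintro k s' hk ⟨h, h14⟩
    have hev := h.setup.evaluates h.tab
    have hlen : (l ++ (L.kindList j k).flatMap two).length + 2 ≤ 2 ^ W := by
      have := length_kindList_le L j k
      rw [List.length_append, length_flatMap_two]
      omega
    have hlt := decoded_lt L hj hk
    have next : ∀ s'' l', Writing W b m a₀ F l' s'' → s''.reg 14 = k →
        l' = l ++ (L.kindList j (k + 1)).flatMap two → s''.Bounded W ∧ s''.reg 14 = k ∧
        Writing W b m a₀ F (l ++ (L.kindList j (k + 1)).flatMap two) (s''.setReg 14 (k + 1)) ∧
        (s''.setReg 14 (k + 1)).reg 14 = k + 1 := fun s'' l' h h14 hl' =>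
      ⟨h.setup.bounded, h14, (h.setReg (by simp) (by simp) (by omega)).congr hl', by simp⟩
    refine Within.branch h.setup.bounded hW one_pos (fun hp => ?_) (fun hp => ?_)
    · rw [hev.present, Expr.eval_reg, h14] at hp
      have hsrc : (lay.decoded j (.reg 14)).2.1.eval s' = (L.decoded j k).2.1 := by
        rw [hev.src, Expr.eval_reg, h14]
      refine Within.seq (push_within hW one_pos h hsrc (by omega) (by omega)) ?_
      rintro s₁ ⟨h₁, h14'⟩
      rw [h14] at h14'
      have hdst : (lay.decoded j (.reg 14)).2.2.eval s₁ = (L.decoded j k).2.2 := by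
        rw [(h₁.setup.evaluates h₁.tab).dst, Expr.eval_reg, h14']
      refine (push_within hW one_pos h₁ hdst (by omega) ?_).mono le_rfl ?_
      · rw [List.length_append, List.length_singleton]; omega
      · rintro s₂ ⟨h₂, h14''⟩
        refine next s₂ _ h₂ (h14''.trans h14') ?_
        rw [kindList_succ, if_pos hp]
        simp [two]
    · rw [hev.present, Expr.eval_reg, h14] at hp
      refine Within.skip hW one_pos (next s' _ h h14 ?_)
      rw [kindList_succ, if_neg (not_not.2 hp), List.append_nil]

theorem kinds_within (hW : 0 < W)
    (hfit : (layout b m ∅).size + 20 * (layout b m ∅).total + 2 ≤ 2 ^ W) (js : List ℕ)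
    (hj : ∀ j ∈ js, j < 10) {l : List ℕ} {s : State} (h : Writing W b m a₀ F l s)
    (hl : l.length + 2 * (js.length * (layout b m F).total) ≤ 2 ^ W) :
    Within W ((layout b m F).total + 1) (kindsProg js) s
      (Writing W b m a₀ F
        (l ++ (js.flatMap fun j => (layout b m F).kindList j (layout b m F).total).flatMap two)) := by
  induction js generalizing l s with
  | nil => exact Within.skip hW (by simp) (h.congr (by simp))
  | cons j js ih =>
    rw [List.length_cons, add_mul, one_mul] at hl
    refine Within.seq (kind_within hW hfit h (hj j (by simp)) (by omega)) fun s' h' => ?_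
    refine (ih (fun i hi => hj i (by simp [hi])) h' ?_).mono le_rfl fun s'' h'' =>
      h''.congr (by simp)
    have := length_kindList_le (layout b m F) j (layout b m F).total
    rw [List.length_append, length_flatMap_two]
    omega

lemma encodeGraph_edgeList (L : Layout ℕ) : encodeGraph L.size L.edgeList =
    L.size :: L.edgeList.length ::
      ((List.range 10).flatMap fun j => L.kindList j L.total).flatMap two := by
  rw [encodeGraph, ← L.edgeList_map, List.flatMap_map]
  rfl

theorem graph_within (hW : 0 < W)
    (hfit : (layout b m ∅).size + 20 * (layout b m ∅).total + 2 ≤ 2 ^ W)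
    (h : Writing W b m a₀ F [] s) :
    Within W ((layout b m F).total + 1) graphProg s
      (Out (encodeGraph (layout b m F).size (layout b m F).edgeList)) := by
  have hB : 0 < (layout b m F).total + 1 := by simp
  have hfit' : (layout b m F).size + 20 * (layout b m F).total + 2 ≤ 2 ^ W := hfit
  unfold graphProg
  refine Within.seq (push_within hW hB h (h.setup.evaluates h.tab).size (by omega)
    (by simp [Nat.one_le_two_pow])) ?_
  rintro s₁ ⟨h₁, -⟩
  refine Within.seq (push_within hW hB h₁ (v := 0) (by simp) (by omega) (by simp; omega)) ?_
  rintro s₂ ⟨h₂, -⟩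
  refine Within.seq (kinds_within hW hfit _ (by simp) h₂ (by simp; omega)) ?_
  intro s₃ h₃
  refine Within.store h₃.setup.bounded hW hB ?_
  have hE : ((List.range 10).flatMap fun j =>
      (layout b m F).kindList j (layout b m F).total).length = (layout b m F).edgeList.length := by
    rw [← edgeList_map, List.length_map]
  have := h₃.out.set (i := 1) (by simp) (layout b m F).edgeList.length
  rw [encodeGraph_edgeList]
  have hv : ((Expr.reg 20 - .const 2) / .const 2).eval s₃ = (layout b m F).edgeList.length := by
    simp only [Expr.eval_div, Expr.eval_sub, Expr.eval_reg, h₃.out.length, Expr.eval_const,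
      List.length_append, length_flatMap_two, hE]
    simp
  rw [hv]
  simpa using this

/-- The construction of the graph of a formula. -/
theorem build_within {b₀ n : ℕ} {cl : List (List ℕ)} (hfit : Fits W b cl.length (encodeCodes n cl))
    (hW : 0 < W) (hb₀ : 0 < b₀) (hb : b₀ + ((n + 4) / 5 - b₀) = b) {N : ℕ}
    (hN : ∀ c ∈ cl, c.length + 1 ≤ N) (hN0 : 0 < N) :
    Within W ((cl.length + 1) * N * ((layout b cl.length ∅).total + 1)) (buildProg b₀)
      (start (encodeCodes n cl))
      (Out (encodeGraph (layout b cl.length (zeroSet b cl)).size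
        (layout b cl.length (zeroSet b cl)).edgeList)) := by
  have hM := M_le_total (b := b) (m := cl.length)
  have hone : 1 ≤ (cl.length + 1) * N := Nat.mul_pos (by simp) hN0
  have hle : (layout b cl.length ∅).total + 1 ≤
      (cl.length + 1) * N * ((layout b cl.length ∅).total + 1) := Nat.le_mul_of_pos_left _ hone
  unfold buildProg
  refine Within.seq ((setup_within hfit hW (by simp [encodeCodes]) (by simp [encodeCodes]) hb).mono
    ?_ fun _ h => h) ?_
  · have := Nat.lt_two_pow_self (n := b)
    omega
  · rintro s ⟨h₁, h₂, h₃⟩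
    refine Within.seq ((table_within hW (by omega) hfit.M hfit.length (fun _ => rfl) hN hN0
      ⟨h₁, h₂, h₃⟩).mono ?_ fun _ h => h) ?_
    · rw [← mul_assoc]; gcongr
    · intro s h
      exact (graph_within hW hfit.graph ⟨h.setup, h.tab, h.out⟩).mono hle fun _ h => h

end Reduction

/-! ### Satisfying assignments as five vectors without a common one -/

namespace Reduction

open RAM Layout

/-- The code of a literal. -/
def literalCode {n : ℕ} (l : Fin n × Bool) : ℕ := 2 * (l.1 : ℕ) + (if l.2 then 1 else 0)

/-- The clauses of a formula with coded literals. -/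
def codes {n : ℕ} (φ : CNF n) : List (List ℕ) := φ.map fun c => c.map literalCode

lemma encode_eq {n : ℕ} (φ : CNF n) : φ.encode = encodeCodes n (codes φ) := by
  simp [CNF.encode, encodeCodes, codes, List.flatMap_map]
  rfl

lemma literalCode_div {n : ℕ} (l : Fin n × Bool) : literalCode l / 2 = l.1 := by
  unfold literalCode; split <;> omega

lemma literalCode_mod {n : ℕ} (l : Fin n × Bool) : literalCode l % 2 = l.2.toNat := by
  unfold literalCode; cases l.2 <;> simp

lemma literalTrue_iff {n b a : ℕ} (l : Fin n × Bool) : LiteralTrue b a (literalCode l) ↔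
    a / 2 ^ b = l.1 / b ∧ a.testBit (l.1 % b) = l.2 := by
  rw [LiteralTrue, literalCode_div, literalCode_mod, Nat.testBit_eq_decide_div_mod_eq]
  have : a / 2 ^ ((l.1 : ℕ) % b) % 2 < 2 := Nat.mod_lt _ (by simp)
  refine and_congr_right fun _ => ?_
  cases l.2 <;> simp

variable {b : ℕ}

lemma mul_add_unique {d a c a' c' : ℕ} (hc : c < d) (hc' : c' < d) (h : a * d + c = a' * d + c') :
    a = a' ∧ c = c' := by
  have hd : 0 < d := by omega
  have h1 : (a * d + c) / d = a := by
    rw [mul_comm, Nat.mul_add_div hd, Nat.div_eq_of_lt hc, add_zero]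
  have h2 : (a' * d + c') / d = a' := by
    rw [mul_comm, Nat.mul_add_div hd, Nat.div_eq_of_lt hc', add_zero]
  have : a = a' := by rw [← h1, ← h2, h]
  subst this
  exact ⟨rfl, by omega⟩

lemma block_lt {a : ℕ} (ha : a < 5 * 2 ^ b) : a / 2 ^ b < 5 :=
  (Nat.div_lt_iff_lt_mul (by positivity)).2 ha

/-- Row and column can be recovered from the cell, since all columns are below `cl.length + 5`; for
the block coordinates this holds because there are only five blocks. -/
lemma mem_zeroSet {cl : List (List ℕ)} {a c : ℕ} (ha : a < 5 * 2 ^ b) (hc : c < cl.length + 5) :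
    a * (cl.length + 5) + c ∈ zeroSet b cl ↔
      (c < cl.length ∧ ∃ l ∈ cl.getD c [], LiteralTrue b a l) ∨ c = cl.length + a / 2 ^ b := by
  constructor
  · rintro (⟨a', ha', c', hc', h, hl⟩ | ⟨a', ha', h⟩)
    · obtain ⟨rfl, rfl⟩ := mul_add_unique hc (by omega) h
      exact .inl ⟨hc', hl⟩
    · have := block_lt ha'
      obtain ⟨rfl, rfl⟩ := mul_add_unique hc (by omega) h
      exact .inr rfl
  · rintro (⟨h, hl⟩ | rfl)
    · exact .inl ⟨a, ha, c, h, rfl, hl⟩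
    · exact .inr ⟨a, ha, rfl⟩

/-- The layout of a formula. -/
noncomputable abbrev formulaLayout (b : ℕ) (cl : List (List ℕ)) : Layout ℕ :=
  layout b cl.length (zeroSet b cl)

lemma one_iff {cl : List (List ℕ)} {a c : ℕ} (ha : a < 5 * 2 ^ b) (hc : c < cl.length + 5) :
    (formulaLayout b cl).One a c ↔
      ¬ ((c < cl.length ∧ ∃ l ∈ cl.getD c [], LiteralTrue b a l) ∨ c = cl.length + a / 2 ^ b) := by
  rw [← mem_zeroSet ha hc, Layout.One]
  simp [layout]

/-- Four vectors leave one of the five blocks free, and all of them have a one at its coordinate. -/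
theorem generic (b : ℕ) (cl : List (List ℕ)) : (formulaLayout b cl).Generic := by
  intro a₁ a₂ a₃ a₄ h₁ h₂ h₃ h₄
  have b₁ := block_lt h₁
  have b₂ := block_lt h₂
  have b₃ := block_lt h₃
  have b₄ := block_lt h₄
  obtain ⟨t, ht, n₁, n₂, n₃, n₄⟩ : ∃ t < 5, t ≠ a₁ / 2 ^ b ∧ t ≠ a₂ / 2 ^ b ∧ t ≠ a₃ / 2 ^ b ∧
      t ≠ a₄ / 2 ^ b := by
    generalize a₁ / 2 ^ b = x₁ at *
    generalize a₂ / 2 ^ b = x₂ at *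
    generalize a₃ / 2 ^ b = x₃ at *
    generalize a₄ / 2 ^ b = x₄ at *
    by_contra! h
    have h0 := h 0; have h1 := h 1; have h2 := h 2; have h3 := h 3; have h4 := h 4
    omega
  have hc : cl.length + t < cl.length + 5 := by omega
  refine ⟨cl.length + t, hc, ?_, ?_, ?_, ?_⟩ <;> rw [one_iff ‹_› hc] <;> omega

lemma getD_codes {n : ℕ} {φ : CNF n} {c : ℕ} (hc : c < (codes φ).length) :
    ∃ h : c < φ.length, (codes φ).getD c [] = φ[c].map literalCode := by
  have h : c < φ.length := by simpa [codes] using hc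
  exact ⟨h, by simp [codes, h]⟩

theorem not_noOrthogonal_of_satisfiable {n : ℕ} (φ : CNF n) (hb : n ≤ 5 * b)
    (h : φ.Satisfiable) : ¬ (formulaLayout b (codes φ)).NoOrthogonal := by
  obtain ⟨v, hv⟩ := h
  -- `w` extends the assignment beyond `n`, `u t` packs block `t` into a number, and `a t` puts the
  -- number of the block in front.
  let w : ℕ → Bool := fun i => if h : i < n then v ⟨i, h⟩ else false
  let u : ℕ → ℕ := fun t => Nat.ofBits fun r : Fin b => w (t * b + r)
  let a : ℕ → ℕ := fun t => 2 ^ b * t + u t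
  have hu : ∀ t, u t < 2 ^ b := fun t => Nat.ofBits_lt_two_pow _
  have hdiv : ∀ t, a t / 2 ^ b = t := fun t => by
    rw [Nat.mul_add_div (by positivity), Nat.div_eq_of_lt (hu t), add_zero]
  have hlt : ∀ t < 5, a t < 5 * 2 ^ b := fun t ht => by
    rw [← Nat.div_lt_iff_lt_mul (by positivity), hdiv]; exact ht
  intro hno
  obtain ⟨c, hc, h⟩ := hno (a 0) (a 1) (a 2) (a 3) (a 4) (hlt 0 (by simp)) (hlt 1 (by simp))
    (hlt 2 (by simp)) (hlt 3 (by simp)) (hlt 4 (by simp))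
  replace hc : c < (codes φ).length + 5 := hc
  have hall : ∀ t < 5, (formulaLayout b (codes φ)).One (a t) c := by
    intro t ht
    interval_cases t <;> tauto
  rcases lt_or_ge c (codes φ).length with hcm | hcm
  · obtain ⟨hcφ, hget⟩ := getD_codes hcm
    obtain ⟨l, hl, hvl⟩ := hv φ[c] (List.getElem_mem hcφ)
    have hln := l.1.2
    have hb0 : 0 < b := by omega
    have ht : (l.1 : ℕ) / b < 5 := (Nat.div_lt_iff_lt_mul hb0).2 (by omega)
    refine (one_iff (hlt _ ht) hc).1 (hall _ ht) (.inl ⟨hcm, literalCode l, ?_, ?_⟩)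
    · rw [hget]; exact List.mem_map_of_mem hl
    · rw [literalTrue_iff]
      refine ⟨hdiv _, ?_⟩
      have hr : (l.1 : ℕ) % b < b := Nat.mod_lt _ hb0
      rw [Nat.testBit_two_pow_mul_add _ (hu _), if_pos hr, Nat.testBit_ofBits_lt _ _ hr, ← hvl]
      simp only [w, Nat.div_add_mod', l.1.2, dite_true]
  · have ht : c - (codes φ).length < 5 := by omega
    refine (one_iff (hlt _ ht) hc).1 (hall _ ht) (.inr ?_)
    rw [hdiv]; omega

/-- The block coordinates force the five vectors to hit all five blocks, hence each exactly once, so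
they patch together to one assignment. At every clause some vector has a zero, that is, makes one of
its literals true. -/
theorem satisfiable_of_not_noOrthogonal {n : ℕ} (φ : CNF n)
    (h : ¬ (formulaLayout b (codes φ)).NoOrthogonal) : φ.Satisfiable := by
  unfold NoOrthogonal at h
  push Not at h
  obtain ⟨a₀, a₁, a₂, a₃, a₄, h₀, h₁, h₂, h₃, h₄, h⟩ := h
  let f : Fin 5 → ℕ := ![a₀, a₁, a₂, a₃, a₄]
  have hf : ∀ k, f k < 5 * 2 ^ b := by
    intro k; fin_cases k <;> assumption
  have hex : ∀ c < (codes φ).length + 5, ∃ k, ¬ (formulaLayout b (codes φ)).One (f k) c := by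
    intro c hc
    by_contra! hall
    exact h c hc (hall 0) (hall 1) (hall 2) (hall 3) (hall 4)
  let τ : Fin 5 → Fin 5 := fun k => ⟨f k / 2 ^ b, block_lt (hf k)⟩
  have hτ : Function.Surjective τ := by
    intro t
    have hc : (codes φ).length + t < (codes φ).length + 5 := by omega
    obtain ⟨k, hk⟩ := hex _ hc
    rw [one_iff (hf k) hc, not_not] at hk
    refine ⟨k, Fin.ext ?_⟩
    simp only [τ]
    omega
  have hinj : Function.Injective τ := Finite.injective_iff_surjective.2 hτ
  choose g hg using hτ
  -- A literal made true by a vector lies in one of the five blocks, so the default is never used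
  -- for it.
  refine ⟨fun i => if hi : (i : ℕ) / b < 5 then (f (g ⟨i / b, hi⟩)).testBit (i % b) else false,
    fun c hc => ?_⟩
  obtain ⟨j, hj, rfl⟩ := List.mem_iff_getElem.1 hc
  have hj' : j < (codes φ).length := by simpa [codes] using hj
  obtain ⟨hjφ, hget⟩ := getD_codes hj'
  obtain ⟨k, hk⟩ := hex j (by omega)
  rw [one_iff (hf k) (by omega), not_not] at hk
  obtain ⟨-, l', hl', ht⟩ : j < (codes φ).length ∧ ∃ l ∈ (codes φ).getD j [],
    LiteralTrue b (f k) l := hk.resolve_right fun h =>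
    absurd hj' (by rw [h]; simp)
  rw [hget] at hl'
  obtain ⟨l, hl, rfl⟩ := List.mem_map.1 hl'
  rw [literalTrue_iff] at ht
  have hlt : (l.1 : ℕ) / b < 5 := ht.1 ▸ block_lt (hf k)
  have hgk : g ⟨(l.1 : ℕ) / b, hlt⟩ = k := hinj (by rw [hg]; exact Fin.ext ht.1.symm)
  exact ⟨l, hl, by simp only [hlt, dite_true, hgk, ht.2]⟩

/-- The diameter of the graph of a formula. -/
theorem diam_formula {n : ℕ} (φ : CNF n) (hb : n ≤ 5 * b) :
    (formulaLayout b (codes φ)).graph.Connected ∧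
      (¬ φ.Satisfiable → (formulaLayout b (codes φ)).graph.diam ≤ 5) ∧
      (φ.Satisfiable → 9 ≤ (formulaLayout b (codes φ)).graph.diam) := by
  obtain ⟨h, h₁, h₂⟩ := (formulaLayout b (codes φ)).graph_diam layout_M_pos
    (by simp [layout]) rfl (generic b _)
  refine ⟨h, fun hs => h₁ ?_, fun hs => h₂ (not_noOrthogonal_of_satisfiable φ hb hs)⟩
  by_contra hno
  exact hs (satisfiable_of_not_noOrthogonal φ hno)

end Reduction

/-! ### Sizes, and the decision procedure -/

namespace Reduction

open RAM Layout

variable {b : ℕ}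

lemma size_le (m : ℕ) (F : Set ℕ) :
    (layout b m F).size ≤ 5 * ((5 * 2 ^ b) ^ 4 * (m + 5) ^ 6) := by
  simp only [Layout.size, layout]
  have hM : 1 ≤ 5 * 2 ^ b := layout_M_pos
  have hD : 1 ≤ (m + 5) ^ 6 := Nat.one_le_pow _ _ (by simp)
  rw [show (m + 5) * (m + 5) * (m + 5) * (m + 5) * (m + 5) * (m + 5) = (m + 5) ^ 6 by ring]
  generalize 5 * 2 ^ b = M at *
  generalize (m + 5) ^ 6 = D at *
  have h1 : M * M * M * M * 1 ≤ M ^ 4 * D := by rw [show M * M * M * M = M ^ 4 by ring]; gcongr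
  have h2 : M * M * M * D ≤ M ^ 4 * D := by
    rw [show M * M * M = M ^ 3 by ring]
    exact Nat.mul_le_mul (Nat.pow_le_pow_right hM (by norm_num)) (by omega)
  have h3 : M * M * D ≤ M ^ 4 * D := by
    rw [show M * M = M ^ 2 by ring]
    exact Nat.mul_le_mul (Nat.pow_le_pow_right hM (by norm_num)) (by omega)
  have h4 : M * M * 1 ≤ M ^ 4 * D := by
    rw [show M * M = M ^ 2 by ring]
    exact Nat.mul_le_mul (Nat.pow_le_pow_right hM (by norm_num)) (by omega)
  omega

lemma le_size (m : ℕ) (F : Set ℕ) : (5 * 2 ^ b) ^ 4 ≤ (layout b m F).size := by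
  simp only [Layout.size, layout]
  rw [show (5 * 2 ^ b) ^ 4 = 5 * 2 ^ b * (5 * 2 ^ b) * (5 * 2 ^ b) * (5 * 2 ^ b) by ring]
  exact Nat.le_add_right _ _

lemma total_eq (m : ℕ) (F : Set ℕ) :
    (layout b m F).total = (5 * 2 ^ b) ^ 4 * (m + 5) ^ 12 := by
  simp only [Layout.total, layout]; ring

section

variable {n : ℕ} {φ : CNF n}

lemma length_clause_le (hφ : ∀ c ∈ φ, c.Nodup) {c : List ℕ} (hc : c ∈ codes φ) :
    c.length ≤ 2 * n := by
  obtain ⟨c', hc', rfl⟩ := List.mem_map.1 hc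
  rw [List.length_map]
  refine (hφ c' hc').length_le_card.trans ?_
  simp; omega

lemma length_codes : (codes φ).length = φ.length := by simp [codes]

lemma length_encode_le (hφ : ∀ c ∈ φ, c.Nodup) :
    (encodeCodes n (codes φ)).length ≤ 2 + φ.length * (2 * n + 1) := by
  have : ((codes φ).flatMap fun c => c.length :: c).length ≤ φ.length * (2 * n + 1) := by
    rw [List.length_flatMap]
    refine (List.sum_le_card_nsmul _ (2 * n + 1) ?_).trans (by simp [length_codes])
    intro x hx
    obtain ⟨c, hc, rfl⟩ := List.mem_map.1 hx
    simpa using length_clause_le hφ hc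
  simp only [encodeCodes, List.length_cons]
  omega

lemma cell_le (hφ : ∀ c ∈ φ, c.Nodup) (j : ℕ) :
    (encodeCodes n (codes φ)).getD j 0 ≤ 2 * n + 1 + φ.length := by
  have key : ∀ x ∈ encodeCodes n (codes φ), x ≤ 2 * n + 1 + φ.length := by
    intro x hx
    simp only [encodeCodes, List.mem_cons, List.mem_flatMap, length_codes] at hx
    rcases hx with rfl | rfl | ⟨c, hc, rfl | hx⟩
    · omega
    · omega
    · have := length_clause_le hφ hc; omega
    · obtain ⟨c, -, rfl⟩ := List.mem_map.1 hc
      obtain ⟨l, -, rfl⟩ := List.mem_map.1 hx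
      have := l.1.2
      have : literalCode l < 2 * n := by unfold literalCode; split <;> omega
      omega
  rw [List.getD_eq_getElem?_getD]
  rcases h : (encodeCodes n (codes φ))[j]? with _ | x
  · simp
  · exact key x (List.mem_of_getElem? h)

/-- `W` enters the time only as a factor, so it need only be polynomial in `b` and the number of
clauses; the wasteful `d ≤ 2 ^ d` is good enough. -/
lemma fits (hφ : ∀ c ∈ φ, c.Nodup) (hb : 0 < b) (hn : n ≤ 5 * b) :
    Fits (16 * ((φ.length + 5) * b)) b (codes φ).length (encodeCodes n (codes φ)) := by
  rw [length_codes]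
  generalize hd : φ.length + 5 = d
  have hd5 : 5 ≤ d := by omega
  have h1 : 5 * b ≤ d * b := Nat.mul_le_mul_right _ hd5
  have h2 : d * 1 ≤ d * b := Nat.mul_le_mul_left _ hb
  have hself : 16 * (d * b) ≤ 2 ^ (16 * (d * b)) := Nat.lt_two_pow_self.le
  refine ⟨fun j => (cell_le hφ j).trans ?_, (length_encode_le hφ).trans ?_, ?_⟩
  · omega
  · have : φ.length * (2 * n + 1) ≤ d * (11 * b) := Nat.mul_le_mul (by omega) (by omega)
    have : d * (11 * b) = 11 * (d * b) := by ring
    omega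
  · have hs := size_le (b := b) φ.length ∅
    rw [total_eq, hd] at *
    have h6 : (5 * 2 ^ b) ^ 4 * d ^ 6 ≤ (5 * 2 ^ b) ^ 4 * d ^ 12 :=
      Nat.mul_le_mul_left _ (Nat.pow_le_pow_right (by omega) (by simp))
    have h7 : 1 ≤ (5 * 2 ^ b) ^ 4 * d ^ 12 :=
      Nat.mul_pos (by positivity) (Nat.pow_pos (by omega))
    -- `27 = 5 + 20 + 2`: the five layers, the output of the edges, and the constant.
    calc _ ≤ 27 * ((5 * 2 ^ b) ^ 4 * d ^ 12) := by omega
      _ = 27 * 625 * 2 ^ (4 * b) * d ^ 12 := by rw [mul_pow, ← pow_mul, mul_comm b 4]; ring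
      _ ≤ 2 ^ 15 * 2 ^ (4 * b) * (2 ^ d) ^ 12 := by
          gcongr
          · norm_num
          · exact Nat.lt_two_pow_self.le
      _ = 2 ^ (15 + 4 * b + 12 * d) := by rw [← pow_mul, mul_comm d 12, pow_add, pow_add]
      _ ≤ _ := Nat.pow_le_pow_right (by simp) (by omega)

end

/-- The program deciding satisfiability with the help of the program `p`. -/
def decideProg (b₀ : ℕ) (p : Prog) : Prog :=
  -- The given program works from place 20 on, where the graph stands. The truncated difference is
  -- nonzero exactly for outputs above five.
  .seq (buildProg b₀) (.seq (p.shift 20) (.assign 0 (.reg 20 - .const 5)))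

lemma diam_lt_card {V : Type} [Fintype V] {G : SimpleGraph V} (h : G.Connected) :
    G.diam < Fintype.card V := by
  have := h.nonempty
  obtain ⟨u, v, huv⟩ := G.exists_dist_eq_diam
  obtain ⟨w, hw, hl⟩ := h.exists_path_of_dist u v
  rw [← huv, ← hl]
  exact hw.length_lt

lemma size_le_self (n : ℕ) : n.size ≤ n := Nat.size_le.2 Nat.lt_two_pow_self

/-- Since `9 / 5 * 5 = 9`, a value `D' ≤ 5` certifies `D < 9`. -/
lemma isApprox_iff {α : ℝ} (hα : α < 9 / 5) {D D' : ℕ} (h : IsApprox α D D') :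
    (D ≤ 5 → D' - 5 = 0) ∧ (9 ≤ D → D' - 5 ≠ 0) := by
  refine ⟨fun hD => ?_, fun hD h0 => ?_⟩
  · have := h.2; omega
  · have h5 : D' ≤ 5 := by omega
    have h1 := h.1
    have hD' : (9 : ℝ) ≤ D := by exact_mod_cast hD
    have h5' : (D' : ℝ) ≤ 5 := by exact_mod_cast h5
    have h0' : (0 : ℝ) ≤ D' := by positivity
    rcases h0'.eq_or_lt with h' | h'
    · rw [← h'] at h1; linarith
    · nlinarith

theorem decide_halts {p : Prog} {α : ℝ} (hα : α < 9 / 5) {E T : ℕ → ℝ}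
    (hp : ApproximatesDiameter p α E T) {b₀ n : ℕ} (hb₀ : 0 < b₀)
    (hb : b₀ + ((n + 4) / 5 - b₀) = b) (φ : CNF n) (hφ : ∀ c ∈ φ, c.Nodup)
    (hE : (10 : ℝ) * ((5 * 2 ^ b) ^ 4 * (φ.length + 5 : ℕ) ^ 12) ≤
      E (formulaLayout b (codes φ)).size) :
    ∃ t out, HaltsWith (decideProg b₀ p) φ.encode t out ∧ (out ≠ 0 ↔ φ.Satisfiable) ∧
      (t : ℝ) ≤ (buildProg b₀).rate * ((φ.length + 1) * (2 * n + 1) *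
        ((5 * 2 ^ b) ^ 4 * (φ.length + 5) ^ 12 + 1)) * (16 * ((φ.length + 5) * b)) +
        T (formulaLayout b (codes φ)).size + (2 * (formulaLayout b (codes φ)).size + 10) := by
  have hb0 : 0 < b := by omega
  have hn : n ≤ 5 * b := by omega
  set L := formulaLayout b (codes φ) with hL
  obtain ⟨hconn, hno, hyes⟩ := diam_formula φ hn
  have hlen : ((L.edgeList.length : ℕ) : ℝ) ≤ E L.size := by
    refine le_trans ?_ hE
    have := L.length_edgeList_le
    rw [hL, total_eq, length_codes, ← hL] at this
    exact_mod_cast this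
  obtain ⟨t, out, ⟨s', hexec, hout⟩, ht, happ⟩ := hp L.size L.graph L.edgeList hconn
    (L.isEdgeList layout_M_pos layout_D_pos) hlen
  obtain ⟨t₁, s₁, h₁, ht₁, hs₁⟩ := build_within (b₀ := b₀) (fits hφ hb0 hn) (by positivity) hb₀ hb
    (N := 2 * n + 1) (fun c hc => by have := length_clause_le hφ hc; omega) (by simp)
  obtain ⟨s₂, h₂, hs₂⟩ := hexec.shift hs₁.shifted
  have hr : s₂.reg 20 = out := by simpa [hout] using hs₂.1 0
  refine ⟨t₁ + (t + ((Expr.reg 20 - .const 5).cost s₂ + 1)), out - 5,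
    ⟨s₂.setReg 0 ((Expr.reg 20 - .const 5).eval s₂), ?_, ?_⟩, ?_, ?_⟩
  · rw [encode_eq]; exact .seq h₁ (.seq h₂ (.assign _ _ _))
  · simp [hr]
  · obtain ⟨h5, h9⟩ := isApprox_iff hα happ
    refine ⟨fun h => ?_, fun h => h9 (hyes h)⟩
    by_contra hs
    exact h (h5 (hno hs))
  -- The output is at most the diameter, hence below the number of vertices; charging its value
  -- instead of its bit length is affordable.
  · have hcost : (Expr.reg 20 - .const 5).cost s₂ + 1 ≤ 2 * L.size + 10 := by
      have e1 : (Expr.reg 20 - .const 5).cost s₂ =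
        ((s₂.reg 20).size + 1) + ((5 : ℕ).size + 1) + (s₂.reg 20 - 5).size + 1 := rfl
      have h1 := size_le_self (s₂.reg 20)
      have h2 := size_le_self (s₂.reg 20 - 5)
      have h3 := size_le_self 5
      have h4 := diam_lt_card hconn
      have h5 := happ.2
      rw [Fintype.card_fin] at h4
      change L.graph.diam < L.size at h4
      omega
    have ht₁' : (t₁ : ℝ) ≤ (buildProg b₀).rate * ((φ.length + 1) * (2 * n + 1) *
        ((5 * 2 ^ b) ^ 4 * (φ.length + 5) ^ 12 + 1)) * (16 * ((φ.length + 5) * b)) := by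
      rw [total_eq, length_codes] at ht₁
      exact_mod_cast ht₁
    have hc' : (((Expr.reg 20 - .const 5).cost s₂ + 1 : ℕ) : ℝ) ≤ 2 * L.size + 10 := by
      exact_mod_cast hcost
    push_cast at hc' ⊢
    linarith

end Reduction

/-! ### Asymptotics of the running time -/

namespace Reduction

open RAM Layout Filter

lemma tendsto_pow_div_two_rpow (k : ℕ) {γ : ℝ} (hγ : 0 < γ) :
    Tendsto (fun b : ℕ => (b : ℝ) ^ k / (2 : ℝ) ^ (γ * b)) atTop (nhds 0) := by
  have := tendsto_pow_const_div_const_pow_of_one_lt k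
    (Real.one_lt_rpow (by norm_num : (1 : ℝ) < 2) hγ)
  simpa only [Real.rpow_mul_natCast (by norm_num : (0 : ℝ) ≤ 2)] using this

lemma exists_pow_le_two_rpow (k : ℕ) {γ : ℝ} (hγ : 0 < γ) :
    ∃ c : ℝ, 0 ≤ c ∧ ∀ b : ℕ, (b : ℝ) ^ k ≤ c * (2 : ℝ) ^ (γ * b) := by
  obtain ⟨c, hc⟩ := (tendsto_pow_div_two_rpow k hγ).bddAbove_range
  refine ⟨max c 0, le_max_right _ _, fun b => ?_⟩
  have h := hc ⟨b, rfl⟩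
  have hpos : (0 : ℝ) < (2 : ℝ) ^ (γ * b) := by positivity
  rw [div_le_iff₀ hpos] at h
  exact h.trans (by gcongr; exact le_max_left _ _)

lemma exists_forall_pow_le (k : ℕ) {γ : ℝ} (hγ : 0 < γ) (a : ℝ) :
    ∃ b₀ : ℕ, 0 < b₀ ∧ ∀ b ≥ b₀, a * (b : ℝ) ^ k ≤ (2 : ℝ) ^ (γ * b) := by
  have := ((tendsto_pow_div_two_rpow k hγ).const_mul a).eventually_le_const
    (by simp : a * 0 < (1 : ℝ))
  obtain ⟨b₀, h⟩ := eventually_atTop.1 this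
  refine ⟨b₀ + 1, by simp, fun b hb => ?_⟩
  have h := h b (by omega)
  have hpos : (0 : ℝ) < (2 : ℝ) ^ (γ * b) := by positivity
  rwa [← mul_div_assoc, div_le_one hpos] at h

lemma two_rpow_four_mul (b : ℕ) : (2 : ℝ) ^ (4 * (b : ℝ)) = 16 ^ b := by
  rw [Real.rpow_mul_natCast (by norm_num)]
  norm_num

/-- The number of possible edges is small compared to the number of vertices. -/
lemma edges_le {η : ℝ} (hη : 0 < η) {A b d V : ℕ} (hd : d ≤ A * b) (hV : (5 * 2 ^ b) ^ 4 ≤ V)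
    (hb : (10 * (A : ℝ) ^ 12) * (b : ℝ) ^ 12 ≤ (2 : ℝ) ^ (η * b)) :
    (10 : ℝ) * ((5 * 2 ^ b) ^ 4 * (d : ℝ) ^ 12) ≤ (V : ℝ) ^ (1 + η) := by
  have hV' : ((5 : ℝ) * 2 ^ b) ^ 4 ≤ V := by exact_mod_cast hV
  have hd' : (d : ℝ) ≤ A * b := by exact_mod_cast hd
  have h2 : (2 : ℝ) ^ b ≤ V := by
    refine le_trans ?_ hV'
    have h1 : (1 : ℝ) ≤ 2 ^ b := one_le_pow₀ (by norm_num)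
    calc (2 : ℝ) ^ b = 2 ^ b * 1 ^ 3 := by ring
      _ ≤ (5 * 2 ^ b) * (5 * 2 ^ b) ^ 3 := by gcongr <;> linarith
      _ = _ := by ring
  have hVpos : (0 : ℝ) < V := lt_of_lt_of_le (by positivity) h2
  rw [Real.rpow_add hVpos, Real.rpow_one]
  calc (10 : ℝ) * ((5 * 2 ^ b) ^ 4 * (d : ℝ) ^ 12)
      ≤ 10 * ((5 * 2 ^ b) ^ 4 * (A * b : ℝ) ^ 12) := by gcongr
    _ = (5 * 2 ^ b) ^ 4 * ((10 * (A : ℝ) ^ 12) * (b : ℝ) ^ 12) := by ring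
    _ ≤ V * (2 : ℝ) ^ (η * b) := by gcongr
    _ = V * ((2 : ℝ) ^ b) ^ η := by
        rw [mul_comm η, Real.rpow_mul (by norm_num), Real.rpow_natCast]
    _ ≤ V * (V : ℝ) ^ η := by gcongr

/-- The running time of the approximation on a graph of the reduction. -/
lemma approx_time_le {δ : ℝ} (hδ : 0 < δ) (hδ' : δ ≤ 1 / 4) {δ₀ : ℝ} (h₀ : δ ≤ δ₀) (K : ℝ)
    {S b V : ℕ} (hb : 0 < b) (hS : 0 < S) (hV0 : 0 < V) (hV : V ≤ S * b ^ 6 * 16 ^ b) :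
    K * (V : ℝ) ^ (5 / 4 - δ₀) ≤
      |K| * S ^ 2 * ((b : ℝ) ^ 16 * (2 : ℝ) ^ (5 * b - 4 * δ * b : ℝ)) := by
  have hb1 : (1 : ℝ) ≤ b := by exact_mod_cast hb
  have hS1 : (1 : ℝ) ≤ S := by exact_mod_cast hS
  have hV1 : (1 : ℝ) ≤ V := by exact_mod_cast hV0
  have hV' : (V : ℝ) ≤ S * (b : ℝ) ^ 6 * 16 ^ b := by exact_mod_cast hV
  have hSb : (1 : ℝ) ≤ S * (b : ℝ) ^ 6 := one_le_mul_of_one_le_of_one_le hS1 (one_le_pow₀ hb1)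
  have key : (V : ℝ) ^ (5 / 4 - δ₀) ≤
      (S * (b : ℝ) ^ 6) ^ 2 * (2 : ℝ) ^ (5 * b - 4 * δ * b : ℝ) := by
    calc (V : ℝ) ^ (5 / 4 - δ₀) ≤ (V : ℝ) ^ (5 / 4 - δ) :=
          Real.rpow_le_rpow_of_exponent_le hV1 (by linarith)
      _ ≤ (S * (b : ℝ) ^ 6 * 16 ^ b) ^ (5 / 4 - δ) :=
          Real.rpow_le_rpow (by positivity) hV' (by linarith)
      -- Here `16 ^ (5 / 4) = 2 ^ 5` turns the exponent `5 / 4` into `2 ^ (5 * b)`, which is about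
      -- `2 ^ n`.
      _ = (S * (b : ℝ) ^ 6) ^ (5 / 4 - δ) * (2 : ℝ) ^ (5 * b - 4 * δ * b : ℝ) := by
          rw [Real.mul_rpow (by positivity) (by positivity), ← two_rpow_four_mul,
            ← Real.rpow_mul (by norm_num)]
          ring_nf
      _ ≤ _ := by
          gcongr
          calc (S * (b : ℝ) ^ 6) ^ (5 / 4 - δ) ≤ (S * (b : ℝ) ^ 6) ^ (2 : ℝ) :=
                Real.rpow_le_rpow_of_exponent_le hSb (by linarith)
            _ = _ := by norm_cast
  calc K * (V : ℝ) ^ (5 / 4 - δ₀) ≤ |K| * (V : ℝ) ^ (5 / 4 - δ₀) := by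
        gcongr; exact le_abs_self K
    _ ≤ |K| * ((S * (b : ℝ) ^ 6) ^ 2 * (2 : ℝ) ^ (5 * b - 4 * δ * b : ℝ)) := by gcongr
    _ = |K| * S ^ 2 * ((b : ℝ) ^ 12 * (2 : ℝ) ^ (5 * b - 4 * δ * b : ℝ)) := by ring
    _ ≤ _ := by gcongr; simp

/-- The running time of the construction of the graph. -/
lemma build_time_le {r A b d n m : ℕ} (hd : d ≤ A * b) (hm : m + 1 ≤ d) (hn : n ≤ 5 * b)
    (hb : 0 < b) :
    r * ((m + 1) * (2 * n + 1) * ((5 * 2 ^ b) ^ 4 * d ^ 12 + 1)) * (16 * (d * b)) ≤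
      r * 110176 * A ^ 14 * (b ^ 16 * 16 ^ b) := by
  have h1 : 1 ≤ 16 ^ b * (A * b) ^ 12 :=
    Nat.mul_pos (by positivity) (Nat.pow_pos (by omega))
  have h16 : (5 * 2 ^ b) ^ 4 = 625 * 16 ^ b := by
    rw [mul_pow, ← pow_mul, mul_comm b 4, pow_mul]; norm_num
  -- `110176 = 11 * 626 * 16`, with `2 * n + 1 ≤ 11 * b` and `626 = 5 ^ 4 + 1`.
  calc _ ≤ r * ((A * b) * (11 * b) * (625 * 16 ^ b * (A * b) ^ 12 + 16 ^ b * (A * b) ^ 12)) *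
        (16 * ((A * b) * b)) := by
          rw [h16]
          gcongr
          · omega
          · omega
    _ = _ := by ring

/-- Rounding up and the least block length make `5 * b` exceed `n` by at most a constant, which
costs a constant factor. -/
lemma two_rpow_le {δ : ℝ} (hδ : 0 ≤ δ) (hδ' : δ ≤ 1 / 4) {n b b₀ : ℕ}
    (hb : 5 * b ≤ n + (4 + 5 * b₀)) :
    (2 : ℝ) ^ (5 * b - δ * b : ℝ) ≤
      2 ^ (4 + 5 * b₀) * (2 : ℝ) ^ ((1 - δ / 5) * (n : ℝ)) := by
  rw [← Real.rpow_natCast, ← Real.rpow_add (by norm_num)]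
  refine Real.rpow_le_rpow_of_exponent_le (by norm_num) ?_
  have h : (5 * b : ℝ) ≤ n + (4 + 5 * b₀) := by exact_mod_cast hb
  have h' : (1 - δ / 5) * (5 * b : ℝ) ≤ (1 - δ / 5) * (n + (4 + 5 * b₀)) := by
    gcongr; linarith
  have h0 : 0 ≤ δ / 5 * (4 + 5 * b₀ : ℝ) := by positivity
  push_cast
  nlinarith

lemma mul_two_rpow_le {a c x y z : ℝ} (hc : 0 ≤ c) (ha : a ≤ c * (2 : ℝ) ^ x)
    (h : x + y ≤ z) : a * (2 : ℝ) ^ y ≤ c * (2 : ℝ) ^ z := by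
  calc a * (2 : ℝ) ^ y ≤ c * (2 : ℝ) ^ x * (2 : ℝ) ^ y := by gcongr
    _ = c * (2 : ℝ) ^ (x + y) := by rw [Real.rpow_add (by norm_num), mul_assoc]
    _ ≤ c * (2 : ℝ) ^ z :=
        mul_le_mul_of_nonneg_left (Real.rpow_le_rpow_of_exponent_le one_le_two h) hc

end Reduction

open Reduction in
/-- Assuming SETH, a `(9/5 - ε)`-approximation of the diameter needs time `n ^ (5/4 - o(1))`: it is
not possible in time `O(n ^ (5/4 - δ))` for any `δ > 0`, even if only connected graphs with at most
`n ^ (1 + η)` edges have to be dealt with, however small `η > 0` is. -/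
theorem theorem3 (hSETH : SETH) (ε : ℝ) (hε : 0 < ε) (δ : ℝ) (hδ : 0 < δ) (η : ℝ) (hη : 0 < η) :
    ¬ ∃ (p : RAM.Prog) (K : ℝ),
      ApproximatesDiameter p (9 / 5 - ε) (fun n => (n : ℝ) ^ (1 + η))
        (fun n => K * (n : ℝ) ^ (5 / 4 - δ)) := by
  rintro ⟨p, K, hp⟩
  -- A small `δ'` keeps the exponent `5 / 4 - δ'` positive and the construction time, about `2 ^ (4
  -- * b)`, below `2 ^ (5 * b - δ' * b)` up to a constant factor.
  obtain ⟨δ', hδ'0, hδ'4, hδ'⟩ : ∃ δ' : ℝ, 0 < δ' ∧ δ' ≤ 1 / 4 ∧ δ' ≤ δ :=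
    ⟨min δ (1 / 4), by positivity, min_le_right _ _, min_le_left _ _⟩
  obtain ⟨C, hC⟩ := hSETH (δ' / 5) (by positivity)
  -- Then `m + 5 ≤ A * b` for the number `m` of clauses, as `m ≤ C * n` and `n ≤ 5 * b`.
  set A := 5 * C + 5 with hA
  -- From block length `b₀` on the graph is as sparse as required; formulas with few variables are
  -- treated with blocks of this length.
  obtain ⟨b₀, hb₀, hpow⟩ := exists_forall_pow_le 12 hη (10 * (A : ℝ) ^ 12)
  obtain ⟨c, hc0, hc⟩ := exists_pow_le_two_rpow 16 hδ'0
  set S := 3125 * A ^ 6 with hS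
  set R : ℝ := (buildProg b₀).rate * 110176 * A ^ 14 + (2 * S + 10) with hR
  refine hC (decideProg b₀ p) ((R + |K| * S ^ 2) * c * 2 ^ (4 + 5 * b₀)) ?_
  intro n φ hlen hφ
  obtain ⟨b, hb⟩ : ∃ b, b₀ + ((n + 4) / 5 - b₀) = b := ⟨_, rfl⟩
  have hbpos : 0 < b := by omega
  have hn : n ≤ 5 * b := by omega
  have hd : φ.length + 5 ≤ A * b := by
    have h1 : C * n ≤ C * (5 * b) := Nat.mul_le_mul_left _ hn
    have h2 : A * b = C * (5 * b) + 5 * b := by rw [hA]; ring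
    omega
  set L := formulaLayout b (codes φ) with hL
  have hVle : L.size ≤ S * b ^ 6 * 16 ^ b := by
    refine (size_le _ _).trans ?_
    rw [length_codes]
    have h16 : (5 * 2 ^ b) ^ 4 = 625 * 16 ^ b := by
      rw [mul_pow, ← pow_mul, mul_comm b 4, pow_mul]; norm_num
    calc 5 * ((5 * 2 ^ b) ^ 4 * (φ.length + 5) ^ 6)
        ≤ 5 * ((5 * 2 ^ b) ^ 4 * (A * b) ^ 6) := by gcongr
      _ = _ := by rw [h16, hS]; ring
  have hV : (5 * 2 ^ b) ^ 4 ≤ L.size := le_size _ _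
  have hV0 : 0 < L.size := lt_of_lt_of_le (by positivity) hV
  obtain ⟨t, out, hhalt, hsat, ht⟩ := decide_halts (by linarith) hp hb₀ hb φ hφ
    (edges_le hη hd hV (hpow b (by omega)))
  refine ⟨t, out, hhalt, ht.trans ?_, hsat⟩
  have h1 := approx_time_le hδ'0 hδ'4 hδ' K hbpos (by positivity : 0 < S) hV0 hVle
  have h2 : ((buildProg b₀).rate * ((φ.length + 1) * (2 * n + 1) *
      ((5 * 2 ^ b) ^ 4 * (φ.length + 5) ^ 12 + 1)) * (16 * ((φ.length + 5) * b)) : ℝ) ≤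
      (buildProg b₀).rate * 110176 * A ^ 14 * (b ^ 16 * 16 ^ b) := by
    exact_mod_cast build_time_le (r := (buildProg b₀).rate) hd (by omega) hn hbpos
  have h3 : (2 * L.size + 10 : ℝ) ≤ (2 * S + 10) * (b ^ 16 * 16 ^ b) := by
    have hb1 : (1 : ℝ) ≤ b := by exact_mod_cast hbpos
    have h16 : (1 : ℝ) ≤ 16 ^ b := one_le_pow₀ (by norm_num)
    have hVle' : (L.size : ℝ) ≤ S * (b : ℝ) ^ 6 * 16 ^ b := by exact_mod_cast hVle
    have h6 : (b : ℝ) ^ 6 ≤ b ^ 16 := pow_le_pow_right₀ hb1 (by norm_num)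
    have h10 : (1 : ℝ) ≤ b ^ 16 * 16 ^ b :=
      one_le_mul_of_one_le_of_one_le (one_le_pow₀ hb1) h16
    calc (2 * L.size + 10 : ℝ) ≤ 2 * (S * (b : ℝ) ^ 16 * 16 ^ b) + 10 * (b ^ 16 * 16 ^ b) := by
          gcongr
          · exact hVle'.trans (by gcongr)
          · linarith
      _ = _ := by ring
  have hR0 : 0 ≤ R := by positivity
  have hδb : δ' * b ≤ 1 / 4 * b := mul_le_mul_of_nonneg_right hδ'4 (Nat.cast_nonneg b)
  have hb0 : (0 : ℝ) ≤ b := Nat.cast_nonneg b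
  have hδb0 : 0 ≤ δ' * b := mul_nonneg hδ'0.le hb0
  have e1 : (b : ℝ) ^ 16 * 16 ^ b ≤ c * (2 : ℝ) ^ (5 * b - δ' * b : ℝ) := by
    rw [← two_rpow_four_mul]
    exact mul_two_rpow_le hc0 (hc b) (by linarith only [hδb, hb0])
  -- Of the saving `4 * δ' * b` in the exponent, a part absorbs the power of `b`, and `δ' * b` is
  -- kept.
  have e2 : (b : ℝ) ^ 16 * (2 : ℝ) ^ (5 * b - 4 * δ' * b : ℝ) ≤
      c * (2 : ℝ) ^ (5 * b - δ' * b : ℝ) :=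
    mul_two_rpow_le hc0 (hc b) (by linarith only [hδb0])
  have e3 := two_rpow_le (n := n) (b := b) (b₀ := b₀) hδ'0.le hδ'4 (by omega)
  calc _ ≤ (buildProg b₀).rate * 110176 * A ^ 14 * ((b : ℝ) ^ 16 * 16 ^ b) +
        |K| * S ^ 2 * ((b : ℝ) ^ 16 * (2 : ℝ) ^ (5 * b - 4 * δ' * b : ℝ)) +
        (2 * S + 10) * (b ^ 16 * 16 ^ b) := by gcongr
    _ = R * ((b : ℝ) ^ 16 * 16 ^ b) +
        |K| * S ^ 2 * ((b : ℝ) ^ 16 * (2 : ℝ) ^ (5 * b - 4 * δ' * b : ℝ)) := by rw [hR]; ring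
    _ ≤ R * (c * (2 : ℝ) ^ (5 * b - δ' * b : ℝ)) +
        |K| * S ^ 2 * (c * (2 : ℝ) ^ (5 * b - δ' * b : ℝ)) := by gcongr
    _ = (R + |K| * S ^ 2) * c * (2 : ℝ) ^ (5 * b - δ' * b : ℝ) := by ring
    _ ≤ (R + |K| * S ^ 2) * c * (2 ^ (4 + 5 * b₀) * (2 : ℝ) ^ ((1 - δ' / 5) * (n : ℝ))) := by
        gcongr
    _ = _ := by ring
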